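/- Let $a>0$, $b>0$, $E>0$ and, for $\gamma\in\mathbb R$, consider the planar system $$\psi'=v,\qquad v'=2\bigl(\gamma+a\psi^2-b\psi^4\bigr)v-2E\psi ,$$ with Jacobian $J(\gamma)$ at the equilibrium $(0,0)$. Then, for every $\gamma\in\mathbb R$, $$J(\gamma)=\begin{pmatrix}0&1\\-2E&2\gamma\end{pmatrix},\qquad \operatorname{tr}J(\gamma)=2\gamma,\qquad \det J(\gamma)=2E>0,$$ and $\partial_\gamma(\operatorname{tr}J)|_{\gamma=0}=2\neq0$. Moreover, the equilibrium $(0,0)$ undergoes a Hopf bifurcation at $\gamma=0$ with linear frequency $\omega=\sqrt{2E}$. Here a smooth one-parameter family of planar systems $u'=f_p(u)$ is said to undergo a Hopf bifurcation at the point $x_0$ and the parameter value $p_0$, with linear frequency $\omega>0$, if $f_p(x_0)=0$ for all $p$ near $p_0$ and the following hold. 1. The eigenvalues of $Df_{p_0}(x_0)$ are the simple pair $\pm i\omega$, and there is a $C^1$ function $p\mapsto\lambda(p)$ near $p_0$ with $\lambda(p)$ an eigenvalue of $Df_p(x_0)$, $\lambda(p_0)=i\omega$ and $\frac{d}{dp}\operatorname{Re}\lambda(p)\big|_{p=p_0}\neq0$.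 2. For $p$ close to $p_0$, $x_0$ is locally asymptotically stable for $p$ on one side of $p_0$, and repelling (that is, locally asymptotically stable for the time-reversed system) for $p$ on the other side. 3. Periodic orbits emanate from $x_0$: there are $\varepsilon_0>0$, continuous functions $\mu,T:[0,\varepsilon_0)\to\mathbb R$ and $\xi:[0,\varepsilon_0)\to\mathbb R^2$ with $\mu(0)=p_0$, $T(0)=2\pi/\omega$, $\xi(0)=x_0$ such that for each $0<\varepsilon<\varepsilon_0$ the solution of $u'=f_{\mu(\varepsilon)}(u)$ with $u(0)=\xi(\varepsilon)$ is a nonconstant periodic solution with minimal period $T(\varepsilon)$; these orbits shrink to $x_0$ as $\varepsilon\to0^+$; and there are $r,\delta>0$ such that every nonconstant periodic orbit of $u'=f_p(u)$ with $|p-p_0|<\delta$ that stays in the ball of radius $r$ around $x_0$ is one of them (with $\mu(\varepsilon)=p$). -/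

import Mathlib

open Filter Set
open scoped Topology

/-- The amplitude-dependent non-Hermitian coefficient `F(z) = γ + a z - b z²`. -/
def nonreciprocity (γ a b z : ℝ) : ℝ := γ + a * z - b * z ^ 2

/-- The planar vector field `(ψ, v) ↦ (v, 2 F(ψ²) v - 2 E ψ)`; `u 0 = ψ` and `u 1 = v`. -/
def phaseField (a b E γ : ℝ) (u : Fin 2 → ℝ) : Fin 2 → ℝ :=
  ![u 1, 2 * nonreciprocity γ a b (u 0 ^ 2) * u 1 - 2 * E * u 0]

/-- The Jacobian matrix of a planar vector field at a point. -/
noncomputable def jacobian (f : (Fin 2 → ℝ) → (Fin 2 → ℝ)) (x : Fin 2 → ℝ) :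
    Matrix (Fin 2) (Fin 2) ℝ :=
  LinearMap.toMatrix' (fderiv ℝ f x : (Fin 2 → ℝ) →ₗ[ℝ] (Fin 2 → ℝ))

/-- The complex eigenvalues of a real matrix, with algebraic multiplicity. -/
noncomputable def complexEigenvalues (A : Matrix (Fin 2) (Fin 2) ℝ) : Multiset ℂ :=
  (A.map (algebraMap ℝ ℂ)).charpoly.roots

/-- Lyapunov stability of the point `x₀` for `u' = f u`: solutions that start close to `x₀` stay
close to `x₀` for as long as they exist in forward time. -/
def IsLyapunovStable (f : (Fin 2 → ℝ) → (Fin 2 → ℝ)) (x₀ : Fin 2 → ℝ) : Prop :=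
  ∀ ε > 0, ∃ δ > 0, ∀ (τ : ℝ) (y : ℝ → Fin 2 → ℝ),
    IsIntegralCurveOn y (fun _ => f) (Icc 0 τ) → dist (y 0) x₀ < δ →
      ∀ t ∈ Icc 0 τ, dist (y t) x₀ < ε

/-- (Local) asymptotic stability: Lyapunov stability together with attraction of all solutions that
start close to `x₀`. For a `C¹` field, Lyapunov stability makes the solutions that start close to
`x₀` exist for all forward time. -/
def IsAsymptoticallyStable (f : (Fin 2 → ℝ) → (Fin 2 → ℝ)) (x₀ : Fin 2 → ℝ) : Prop :=
  IsLyapunovStable f x₀ ∧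
    ∃ δ > 0, ∀ y : ℝ → Fin 2 → ℝ,
      IsIntegralCurveOn y (fun _ => f) (Ici 0) → dist (y 0) x₀ < δ →
        Tendsto y atTop (𝓝 x₀)

/-- A repelling point: it is asymptotically stable for the time-reversed equation `u' = - f u`. -/
def IsRepelling (f : (Fin 2 → ℝ) → (Fin 2 → ℝ)) (x₀ : Fin 2 → ℝ) : Prop :=
  IsAsymptoticallyStable (fun u => -f u) x₀

/-- The smooth one-parameter family of planar equations `u' = f p u` undergoes a Hopf bifurcation
at the equilibrium `x₀`, at the parameter value `p₀`, with linear frequency `ω`. -/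
structure IsHopfBifurcation (f : ℝ → (Fin 2 → ℝ) → (Fin 2 → ℝ)) (p₀ : ℝ) (x₀ : Fin 2 → ℝ)
    (ω : ℝ) : Prop where
  smooth : ContDiff ℝ (⊤ : ℕ∞) (fun q : ℝ × (Fin 2 → ℝ) => f q.1 q.2)
  equilibrium : ∀ᶠ p in 𝓝 p₀, f p x₀ = 0
  frequency_pos : 0 < ω
  /-- At `p₀` the linearization has the simple eigenvalues `± i ω`. -/
  eigenvalues : complexEigenvalues (jacobian (f p₀) x₀) = {Complex.I * ω, -(Complex.I * ω)}
  /-- The continuation of the eigenvalue `i ω` crosses the imaginary axis with nonzero speed. -/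
  transversality : ∃ (l : ℝ → ℂ) (c : ℝ), ContDiffAt ℝ 1 l p₀ ∧ l p₀ = Complex.I * ω ∧
    (∀ᶠ p in 𝓝 p₀, l p ∈ complexEigenvalues (jacobian (f p) x₀)) ∧
    HasDerivAt (fun p => (l p).re) c p₀ ∧ c ≠ 0
  /-- The equilibrium changes from attracting to repelling, or conversely. -/
  stability_exchange :
    ((∀ᶠ p in 𝓝[<] p₀, IsAsymptoticallyStable (f p) x₀) ∧
      (∀ᶠ p in 𝓝[>] p₀, IsRepelling (f p) x₀)) ∨
    ((∀ᶠ p in 𝓝[<] p₀, IsRepelling (f p) x₀) ∧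
      (∀ᶠ p in 𝓝[>] p₀, IsAsymptoticallyStable (f p) x₀))
  /-- A one-parameter family of periodic orbits `Y ε`, at the parameter value `μ ε` and with minimal
  period `T ε`, emanates from `x₀` at `p₀` with limiting period `2π / ω`, and it exhausts the
  periodic orbits close to `x₀` at parameter values close to `p₀`. -/
  periodic_orbits : ∃ (ε₀ : ℝ) (μ T : ℝ → ℝ) (Y : ℝ → ℝ → Fin 2 → ℝ),
    0 < ε₀ ∧
    ContinuousOn μ (Ico 0 ε₀) ∧ ContinuousOn T (Ico 0 ε₀) ∧
    ContinuousOn (fun ε => Y ε 0) (Ico 0 ε₀) ∧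
    μ 0 = p₀ ∧ T 0 = 2 * Real.pi / ω ∧ Y 0 0 = x₀ ∧
    (∀ ε ∈ Ioo 0 ε₀, IsIntegralCurve (Y ε) (fun _ => f (μ ε)) ∧
      IsLeast {τ : ℝ | 0 < τ ∧ Function.Periodic (Y ε) τ} (T ε)) ∧
    (∀ r > 0, ∀ᶠ ε in 𝓝[>] (0 : ℝ), ∀ t, dist (Y ε t) x₀ < r) ∧
    ∃ r > 0, ∃ δ > 0, ∀ (p : ℝ) (y : ℝ → Fin 2 → ℝ),
      |p - p₀| < δ → IsIntegralCurve y (fun _ => f p) →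
      (∃ τ > 0, Function.Periodic y τ) → (¬ ∃ x, ∀ t, y t = x) →
      (∀ t, dist (y t) x₀ < r) →
        ∃ ε ∈ Ioo 0 ε₀, μ ε = p ∧ Y ε 0 ∈ range y

/-! ### The linearization at the origin -/

/-! Write `w = √(2E)`, `F = γ + aψ² - bψ⁴`, and `ψ = r cos θ`, `v = -w r sin θ`. Then `θ' = w + 2 F
sin θ cos θ` and `r' = 2 r F sin² θ`. For small `γ` and `r` the angle increases with speed near `w`,
so orbits are graphs over the angle of solutions of a scalar, 2π-periodic equation `dr/dθ = r G(γ,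
θ, r)`. Clamping the radius in the right-hand side to `[0, r₀]` makes this equation globally
Lipschitz, hence globally solvable. Small periodic orbits of the plane system correspond to
solutions with `R(2π) = R(0)`.

The closed solutions are found by varying `γ` at a fixed initial radius `x`, without a normal form
or an implicit function theorem. The radius after one turn is strictly increasing in `γ`
(`IsPolarSolution.lt_of_lt`), exceeds `x` when `γ > 0`, and is below `x` when `-γ > a (x e^{2π})²`.
It is also continuous in `γ`, so exactly one parameter `μ x` closes the orbit, and `|μ x| ≤ a (x
e^{2π})²` (`IsSmallRadius.exists_closed_solution`, `IsPolarSolution.parameter_unique`). The same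
monotonicity makes `μ` continuous. The period is the integral of the inverse angular speed over one
turn, and a time change turns the radial solution into a periodic orbit
(`IsPolarSolution.exists_periodic_orbit`).

Conversely, a small nonconstant periodic orbit avoids the origin, lifts to polar coordinates and
closes after some number of turns. Scalar solutions keep their order, so it closes after one turn
and belongs to the family (`IsClosedFamily.exists_amplitude`).

For `γ ≠ 0`, stability comes from a strict Lyapunov function, the energy plus a small multiple of `ψ
v`; reversing time exchanges the two signs of `γ` (`isAsymptoticallyStable_of_damped`). The
eigenvalue statements are read off from the characteristic polynomial. -/

lemma hasFDerivAt_phaseField_zero (a b E γ : ℝ) :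
    HasFDerivAt (phaseField a b E γ)
      (LinearMap.toContinuousLinearMap
        (Matrix.toLin' (!![0, 1; -2 * E, 2 * γ] : Matrix (Fin 2) (Fin 2) ℝ))) 0 := by
  have h (i : Fin 2) : HasFDerivAt (fun u : Fin 2 → ℝ => u i)
      (ContinuousLinearMap.proj (R := ℝ) (φ := fun _ : Fin 2 => ℝ) i) 0 := hasFDerivAt_apply i 0
  -- The coefficient is even in `ψ`, so its derivative vanishes at the origin and only `γ` survives
  -- in the linearization.
  have hz : HasFDerivAt (fun u : Fin 2 → ℝ => nonreciprocity γ a b (u 0 ^ 2))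
      (0 : (Fin 2 → ℝ) →L[ℝ] ℝ) 0 := by
    have h1 : HasDerivAt (fun x : ℝ => nonreciprocity γ a b (x ^ 2)) 0 ((0 : Fin 2 → ℝ) 0) := by
      have := (((hasDerivAt_pow 2 (0 : ℝ)).const_mul a).const_add γ).sub
        (((hasDerivAt_pow 2 (0 : ℝ)).pow 2).const_mul b)
      exact this.congr_deriv (by simp)
    have := h1.comp_hasFDerivAt (0 : Fin 2 → ℝ) (h 0)
    simpa [Function.comp_def] using this
  rw [hasFDerivAt_pi']
  intro i
  fin_cases i
  · refine (h 1).congr_fderiv ?_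
    ext u
    simp [Matrix.toLin'_apply, Matrix.vecHead, Matrix.vecTail]
  · have := ((hz.const_mul 2).mul (h 1)).sub ((h 0).const_mul (2 * E))
    refine this.congr_fderiv ?_
    ext u
    simp [nonreciprocity, Matrix.toLin'_apply, Matrix.vecHead, Matrix.vecTail]
    ring

lemma jacobian_phaseField_zero (a b E γ : ℝ) :
    jacobian (phaseField a b E γ) 0 = !![0, 1; -2 * E, 2 * γ] := by
  rw [jacobian, (hasFDerivAt_phaseField_zero a b E γ).fderiv]
  exact LinearMap.toMatrix'_toLin' _

lemma trace_jacobian_phaseField_zero (a b E γ : ℝ) :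
    (jacobian (phaseField a b E γ) 0).trace = 2 * γ := by
  simp [jacobian_phaseField_zero, Matrix.trace_fin_two]

lemma det_jacobian_phaseField_zero (a b E γ : ℝ) :
    (jacobian (phaseField a b E γ) 0).det = 2 * E := by
  simp [jacobian_phaseField_zero, Matrix.det_fin_two]

lemma charpoly_jacobian_phaseField_zero (a b E γ : ℝ) :
    ((jacobian (phaseField a b E γ) 0).map (algebraMap ℝ ℂ)).charpoly =
      Polynomial.X ^ 2 - Polynomial.C (2 * γ : ℂ) * Polynomial.X + Polynomial.C (2 * E : ℂ) := by
  rw [jacobian_phaseField_zero, Matrix.charpoly_fin_two]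
  simp [Matrix.trace_fin_two, Matrix.det_fin_two]

lemma complexEigenvalues_jacobian_phaseField_zero (a b : ℝ) {E : ℝ} (hE : 0 < E) :
    complexEigenvalues (jacobian (phaseField a b E 0) 0) =
      {Complex.I * (Real.sqrt (2 * E) : ℝ), -(Complex.I * (Real.sqrt (2 * E) : ℝ))} := by
  have hs : ((Real.sqrt (2 * E) : ℝ) : ℂ) ^ 2 = 2 * E := by
    rw [← Complex.ofReal_pow, Real.sq_sqrt (by positivity)]
    push_cast
    ring
  set z : ℂ := Complex.I * (Real.sqrt (2 * E) : ℝ) with hz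
  have hz2 : z * z = -(2 * E) := by
    rw [hz, ← hs]
    linear_combination ((Real.sqrt (2 * E) : ℝ) : ℂ) ^ 2 * Complex.I_mul_I
  have hp : (Polynomial.X ^ 2 - Polynomial.C (2 * (0 : ℝ) : ℂ) * Polynomial.X +
      Polynomial.C (2 * E : ℂ) : Polynomial ℂ) =
      (({z, -z} : Multiset ℂ).map fun w => Polynomial.X - Polynomial.C w).prod := by
    have : (2 * E : ℂ) = -(z * z) := by rw [hz2]; ring
    rw [this]
    simp
    ring
  rw [complexEigenvalues, charpoly_jacobian_phaseField_zero, hp,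
    Polynomial.roots_multiset_prod_X_sub_C]

lemma mem_complexEigenvalues_jacobian_phaseField_zero (a b E γ : ℝ) (hγ : γ ^ 2 ≤ 2 * E) :
    (γ : ℂ) + Complex.I * (Real.sqrt (2 * E - γ ^ 2) : ℝ) ∈
      complexEigenvalues (jacobian (phaseField a b E γ) 0) := by
  have hs : ((Real.sqrt (2 * E - γ ^ 2) : ℝ) : ℂ) ^ 2 = 2 * E - γ ^ 2 := by
    rw [← Complex.ofReal_pow, Real.sq_sqrt (by linarith)]
    push_cast
    ring
  rw [complexEigenvalues, Polynomial.mem_roots (Matrix.charpoly_monic _).ne_zero,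
    charpoly_jacobian_phaseField_zero, Polynomial.IsRoot.def]
  simp
  linear_combination ((Real.sqrt (2 * E - γ ^ 2) : ℝ) : ℂ) ^ 2 * Complex.I_mul_I - hs

lemma eigenvalue_crossing_phaseField (a b : ℝ) {E : ℝ} (hE : 0 < E) :
    ∃ (l : ℝ → ℂ) (c : ℝ), ContDiffAt ℝ 1 l 0 ∧ l 0 = Complex.I * (Real.sqrt (2 * E) : ℝ) ∧
      (∀ᶠ p in 𝓝 (0 : ℝ), l p ∈ complexEigenvalues (jacobian (phaseField a b E p) 0)) ∧
      HasDerivAt (fun p => (l p).re) c 0 ∧ c ≠ 0 := by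
  -- The root of `X² - 2pX + 2E` in the upper half plane; its real part is `p` itself, so the
  -- crossing speed is 1.
  refine ⟨fun p => (p : ℂ) + Complex.I * (Real.sqrt (2 * E - p ^ 2) : ℝ), 1, ?_, by simp, ?_, ?_,
    one_ne_zero⟩
  · have h1 : ContDiffAt ℝ 1 (fun p : ℝ => Real.sqrt (2 * E - p ^ 2)) 0 :=
      ContDiffAt.sqrt (by fun_prop) (by simp; positivity)
    exact (Complex.ofRealCLM.contDiff.contDiffAt (x := (0 : ℝ))).add
      (contDiffAt_const.mul (Complex.ofRealCLM.contDiff.contDiffAt.comp 0 h1))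
  · have : ∀ᶠ p : ℝ in 𝓝 0, p ^ 2 < 2 * E :=
      (by fun_prop : Continuous fun p : ℝ => p ^ 2).continuousAt.eventually_lt_const
        (by simp; positivity)
    filter_upwards [this] with p hp
    exact mem_complexEigenvalues_jacobian_phaseField_zero a b E p hp.le
  · simpa using hasDerivAt_id' (0 : ℝ)

lemma contDiff_phaseField (a b E : ℝ) :
    ContDiff ℝ (⊤ : ℕ∞) (fun q : ℝ × (Fin 2 → ℝ) => phaseField a b E q.1 q.2) := by
  rw [contDiff_pi]
  intro i
  fin_cases i
  · simp [phaseField]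
    fun_prop
  · simp [phaseField, nonreciprocity]
    fun_prop

lemma phaseField_zero (a b E γ : ℝ) : phaseField a b E γ 0 = 0 := by
  ext i
  fin_cases i <;> simp [phaseField]

/-! ### Stability of the origin -/

lemma norm_sq_le_sq_add_sq (u : Fin 2 → ℝ) : ‖u‖ ^ 2 ≤ u 0 ^ 2 + u 1 ^ 2 := by
  have h : ‖u‖ ≤ Real.sqrt (u 0 ^ 2 + u 1 ^ 2) := by
    refine (pi_norm_le_iff_of_nonneg (Real.sqrt_nonneg _)).2 fun i => ?_
    refine Real.abs_le_sqrt ?_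
    fin_cases i <;> simp [sq_nonneg]
  calc ‖u‖ ^ 2 ≤ Real.sqrt (u 0 ^ 2 + u 1 ^ 2) ^ 2 := by gcongr
    _ = _ := Real.sq_sqrt (by positivity)

lemma sq_add_sq_le_norm_sq (u : Fin 2 → ℝ) : u 0 ^ 2 + u 1 ^ 2 ≤ 2 * ‖u‖ ^ 2 := by
  have h (i : Fin 2) : u i ^ 2 ≤ ‖u‖ ^ 2 := by
    rw [← sq_abs]
    gcongr
    exact norm_le_pi_norm u i
  linarith [h 0, h 1]

/-- Lyapunov's criterion, for a function that is comparable with the squared norm and decays at an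
exponential rate along the solutions near the origin. -/
lemma isAsymptoticallyStable_of_lyapunov {f : (Fin 2 → ℝ) → (Fin 2 → ℝ)} {V : (Fin 2 → ℝ) → ℝ}
    {c C k R : ℝ} (hc : 0 < c) (hk : 0 < k) (hR : 0 < R)
    (hV : Differentiable ℝ V) (hVl : ∀ u, c * ‖u‖ ^ 2 ≤ V u) (hVu : ∀ u, V u ≤ C * ‖u‖ ^ 2)
    (hf : ∀ u, ‖u‖ < R → fderiv ℝ V u (f u) ≤ -k * V u) :
    IsAsymptoticallyStable f 0 := by
  -- Comparing the two bounds at a vector of norm 1 gives `0 < c ≤ C`, so the factor `c / C` below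
  -- is in `(0, 1]`.
  have hcC : c ≤ C := by
    have := (hVl ![1, 1]).trans (hVu ![1, 1])
    have h1 : ‖(![1, 1] : Fin 2 → ℝ)‖ = 1 := by
      refine le_antisymm ((pi_norm_le_iff_of_nonneg zero_le_one).2 fun i => ?_) ?_
      · fin_cases i <;> simp
      · simpa using norm_le_pi_norm (![1, 1] : Fin 2 → ℝ) 0
    simpa [h1] using this
  have hC : 0 < C := hc.trans_le hcC
  have hVnn (u) : 0 ≤ V u := le_trans (by positivity) (hVl u)
  have key (s : Set ℝ) (y : ℝ → Fin 2 → ℝ) (hy : IsIntegralCurveOn y (fun _ => f) s) (t : ℝ)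
      (ht : t ∈ s) : HasDerivWithinAt (fun t => V (y t)) (fderiv ℝ V (y t) (f (y t))) s t :=
    (hV (y t)).hasFDerivAt.comp_hasDerivWithinAt t (hy t ht)
  have hstay : ∀ ε > 0, ε ≤ R → ∀ (τ : ℝ) (y : ℝ → Fin 2 → ℝ),
      IsIntegralCurveOn y (fun _ => f) (Icc 0 τ) → ‖y 0‖ < ε * (c / C) →
        ∀ t ∈ Icc 0 τ, ‖y t‖ < ε := by
    intro ε hε hεR τ y hy h0
    have hyc : ContinuousOn (fun t => ‖y t‖) (Icc 0 τ) := hy.continuousOn.norm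
    by_contra! hcon
    have hcomp : IsCompact {t ∈ Icc 0 τ | ε ≤ ‖y t‖} := by
      have := hyc.preimage_isClosed_of_isClosed isClosed_Icc (isClosed_Ici (a := ε))
      exact isCompact_Icc.of_isClosed_subset this fun t ht => ht.1
    -- The first time `s` at which the norm reaches `ε`. Before it the curve stays where `V`
    -- decreases, so `cε² ≤ V(y s) ≤ V(y 0) < cε²`, a contradiction.
    obtain ⟨s, ⟨hs, hsε⟩, hmin⟩ := hcomp.exists_isLeast (by
      obtain ⟨t, ht, h⟩ := hcon
      exact ⟨t, ht, h⟩)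
    have hsub : Icc 0 s ⊆ Icc 0 τ := Icc_subset_Icc_right hs.2
    have hanti : AntitoneOn (fun t => V (y t)) (Icc 0 s) := by
      refine antitoneOn_of_hasDerivWithinAt_nonpos (convex_Icc 0 s)
        (fun t ht => ((key _ y hy t (hsub ht)).continuousWithinAt).mono hsub)
        (f' := fun t => fderiv ℝ V (y t) (f (y t)))
        (fun t ht => (key _ y hy t (hsub (interior_subset ht))).mono
          (interior_subset.trans hsub)) fun t ht => ?_
      rw [interior_Icc] at ht
      have hlt : ‖y t‖ < ε := by
        by_contra! hge
        exact absurd (hmin ⟨⟨ht.1.le, ht.2.le.trans hs.2⟩, hge⟩) (not_le.2 ht.2)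
      refine (hf _ (hlt.trans_le hεR)).trans ?_
      nlinarith [hVnn (y t)]
    have h1 := hanti ⟨le_rfl, hs.1⟩ ⟨hs.1, le_rfl⟩ hs.1
    have h2 := (hVl (y s)).trans (h1.trans (hVu (y 0)))
    have h3 : c * ε ^ 2 ≤ c * ‖y s‖ ^ 2 := by gcongr
    have h4 : C * ‖y 0‖ ^ 2 < C * (ε * (c / C)) ^ 2 := by
      gcongr
    have h5 : C * (ε * (c / C)) ^ 2 = c * ε ^ 2 * (c / C) := by
      field_simp
    have h6 : c / C ≤ 1 := (div_le_one hC).2 hcC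
    have h7 : c * ε ^ 2 * (c / C) ≤ c * ε ^ 2 := mul_le_of_le_one_right (by positivity) h6
    linarith
  constructor
  · intro ε hε
    refine ⟨min ε R * (c / C), by positivity, fun τ y hy h0 t ht => ?_⟩
    rw [dist_zero_right] at h0 ⊢
    exact (hstay (min ε R) (by positivity) (min_le_right _ _) τ y hy h0 t ht).trans_le
      (min_le_left _ _)
  · refine ⟨R * (c / C), by positivity, fun y hy h0 => ?_⟩
    rw [dist_zero_right] at h0
    have hyR : ∀ t ∈ Ici (0 : ℝ), ‖y t‖ < R := fun t ht =>
      hstay R hR le_rfl t y (hy.mono Icc_subset_Ici_self) h0 t ⟨ht, le_rfl⟩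
    have hd : ∀ t ∈ Ici (0 : ℝ), HasDerivWithinAt (fun t => V (y t) * Real.exp (k * t))
        (fderiv ℝ V (y t) (f (y t)) * Real.exp (k * t) + V (y t) * (Real.exp (k * t) * k))
        (Ici 0) t := by
      intro t ht
      have h2 : HasDerivAt (fun t : ℝ => Real.exp (k * t)) (Real.exp (k * t) * k) t := by
        simpa using ((hasDerivAt_id t).const_mul k).exp
      exact (key _ y hy t ht).mul h2.hasDerivWithinAt
    have hanti : AntitoneOn (fun t => V (y t) * Real.exp (k * t)) (Ici 0) := by
      refine antitoneOn_of_hasDerivWithinAt_nonpos (convex_Ici 0)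
        (fun t ht => (hd t ht).continuousWithinAt)
        (fun t ht => (hd t (interior_subset ht)).mono interior_subset) fun t ht => ?_
      have h1 := hf _ (hyR t (interior_subset ht))
      nlinarith [Real.exp_pos (k * t)]
    have hbd : ∀ t ∈ Ici (0 : ℝ), ‖y t‖ ^ 2 ≤ V (y 0) / c * Real.exp (-(k * t)) := by
      intro t ht
      have h1 := hanti self_mem_Ici ht ht
      simp only [mul_zero, Real.exp_zero, mul_one] at h1
      have h2 : V (y t) ≤ V (y 0) * Real.exp (-(k * t)) := by
        rw [Real.exp_neg, ← div_eq_mul_inv, le_div_iff₀ (Real.exp_pos _)]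
        exact h1
      rw [div_mul_eq_mul_div, le_div_iff₀ hc]
      linarith [hVl (y t)]
    have hexp : Tendsto (fun t : ℝ => V (y 0) / c * Real.exp (-(k * t))) atTop (𝓝 0) := by
      have : Tendsto (fun t : ℝ => Real.exp (-(k * t))) atTop (𝓝 0) :=
        Real.tendsto_exp_neg_atTop_nhds_zero.comp (tendsto_id.const_mul_atTop hk)
      simpa using this.const_mul (V (y 0) / c)
    rw [tendsto_zero_iff_norm_tendsto_zero]
    have hsq : Tendsto (fun t => ‖y t‖ ^ 2) atTop (𝓝 0) :=
      squeeze_zero' (Eventually.of_forall fun t => by positivity)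
        ((eventually_ge_atTop 0).mono hbd) hexp
    have := hsq.sqrt
    simpa [Real.sqrt_sq (norm_nonneg _)] using this

/-- The oscillator `ψ' = s v`, `v' = s (2 K(ψ) v - w² ψ)`, `s = ± 1`, is asymptotically stable at
the origin when `s K(0) < 0`. -/
lemma isAsymptoticallyStable_of_damped {f : (Fin 2 → ℝ) → (Fin 2 → ℝ)} {K : ℝ → ℝ} {s w : ℝ}
    (hs : s ^ 2 = 1) (hw : 0 < w) (hK : ContinuousAt K 0) (hK0 : s * K 0 < 0)
    (hf0 : ∀ u, f u 0 = s * u 1) (hf1 : ∀ u, f u 1 = s * (2 * K (u 0) * u 1 - w ^ 2 * u 0)) :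
    IsAsymptoticallyStable f 0 := by
  obtain ⟨g, hg, hgK⟩ : ∃ g > 0, s * K 0 = -g := ⟨-(s * K 0), by linarith, by ring⟩
  obtain ⟨R, hR, hRK⟩ : ∃ R > 0, ∀ x : ℝ, |x| < R → -(2 * g) ≤ s * K x ∧ s * K x ≤ -(g / 2) := by
    have hc : ContinuousAt (fun x => s * K x) 0 := continuousAt_const.mul hK
    have h1 := hc.eventually_const_lt (u := -(2 * g)) (by linarith)
    have h2 := hc.eventually_lt_const (u := -(g / 2)) (by linarith)
    obtain ⟨R, hR, h⟩ := Metric.eventually_nhds_iff.1 (h1.and h2)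
    exact ⟨R, hR, fun x hx => by
      have := h (y := x) (by simpa using hx)
      exact ⟨this.1.le, this.2.le⟩⟩
  -- The weight of the cross term. `κ ≤ w` keeps the cross term below half the energy, `κ ≤ g`
  -- preserves the damping of `v`, and the last bound absorbs the mixed term in the derivative.
  obtain ⟨κ, hκ, hκg, hκw, hκ2⟩ : ∃ κ > 0, κ ≤ g ∧ κ ≤ w ∧ κ * (16 * g) ≤ w ^ 2 := by
    refine ⟨min g (min w (w ^ 2 / (16 * g))), by positivity, min_le_left _ _,
      (min_le_right _ _).trans (min_le_left _ _), ?_⟩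
    rw [← le_div_iff₀ (by positivity)]
    exact (min_le_right _ _).trans (min_le_right _ _)
  have hs1 : |s| = 1 := by
    rw [← sq_abs] at hs
    nlinarith [abs_nonneg s]
  -- The energy alone only decays where `v ≠ 0`; the cross term contributes the missing `-κ w² ψ²`
  -- to the derivative.
  set V : (Fin 2 → ℝ) → ℝ := fun u => u 1 ^ 2 + w ^ 2 * u 0 ^ 2 + s * κ * (u 0 * u 1) with hV
  have hcross (u : Fin 2 → ℝ) : |s * κ * (u 0 * u 1)| ≤ (u 1 ^ 2 + w ^ 2 * u 0 ^ 2) / 2 := by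
    have h1 : |s * κ * (u 0 * u 1)| = κ * (|u 0| * |u 1|) := by
      rw [abs_mul, abs_mul, hs1, abs_of_pos hκ, abs_mul, one_mul]
    have h2 : κ * (|u 0| * |u 1|) ≤ w * (|u 0| * |u 1|) := by gcongr
    rw [h1, ← sq_abs (u 0), ← sq_abs (u 1)]
    nlinarith [sq_nonneg (|u 1| - w * |u 0|)]
  have hVd (u : Fin 2 → ℝ) : HasFDerivAt V
      ((2 * u 1) • ContinuousLinearMap.proj (R := ℝ) (φ := fun _ : Fin 2 => ℝ) 1 +
        (w ^ 2 * (2 * u 0)) • ContinuousLinearMap.proj (R := ℝ) (φ := fun _ : Fin 2 => ℝ) 0 +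
        (s * κ) • (u 0 • ContinuousLinearMap.proj (R := ℝ) (φ := fun _ : Fin 2 => ℝ) 1 +
          u 1 • ContinuousLinearMap.proj (R := ℝ) (φ := fun _ : Fin 2 => ℝ) 0)) u := by
    have h (i : Fin 2) : HasFDerivAt (fun u : Fin 2 → ℝ => u i)
      (ContinuousLinearMap.proj (R := ℝ) (φ := fun _ : Fin 2 => ℝ) i) u := hasFDerivAt_apply i u
    refine ((((h 1).pow 2).add (((h 0).pow 2).const_mul (w ^ 2))).add
      (((h 0).mul (h 1)).const_mul (s * κ))).congr_fderiv ?_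
    ext v
    simp
    ring
  have hm : 0 < min 1 (w ^ 2) := by positivity
  refine isAsymptoticallyStable_of_lyapunov (V := V) (c := min 1 (w ^ 2) / 2)
    (C := 3 * (1 + w ^ 2)) (k := κ / 3) (R := R) (by positivity) (by positivity) hR
    (fun u => (hVd u).differentiableAt) (fun u => ?_) (fun u => ?_) (fun u hu => ?_)
  · have h1 := (abs_le.1 (hcross u)).1
    have h2 : min 1 (w ^ 2) * (u 0 ^ 2 + u 1 ^ 2) ≤ u 1 ^ 2 + w ^ 2 * u 0 ^ 2 := by
      nlinarith [min_le_left 1 (w ^ 2), min_le_right 1 (w ^ 2), sq_nonneg (u 0), sq_nonneg (u 1)]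
    have h3 : min 1 (w ^ 2) * ‖u‖ ^ 2 ≤ min 1 (w ^ 2) * (u 0 ^ 2 + u 1 ^ 2) := by
      gcongr
      exact norm_sq_le_sq_add_sq u
    simp only [hV]
    linarith
  · have h1 := (abs_le.1 (hcross u)).2
    have h2 : (1 + w ^ 2) * (u 0 ^ 2 + u 1 ^ 2) ≤ (1 + w ^ 2) * (2 * ‖u‖ ^ 2) := by
      gcongr
      exact sq_add_sq_le_norm_sq u
    simp only [hV]
    nlinarith [mul_nonneg (sq_nonneg w) (sq_nonneg (u 1)), sq_nonneg (u 0)]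
  · have hu0 : |u 0| < R := (norm_le_pi_norm u 0).trans_lt hu
    obtain ⟨hK1, hK2⟩ := hRK _ hu0
    have hcr := (abs_le.1 (hcross u)).2
    have hder : fderiv ℝ V u (f u) = (4 * (s * K (u 0)) + κ) * u 1 ^ 2
        + 2 * κ * K (u 0) * (u 0 * u 1) - κ * w ^ 2 * u 0 ^ 2 := by
      rw [(hVd u).fderiv]
      simp [hf0, hf1]
      linear_combination (κ * u 1 ^ 2 + 2 * κ * K (u 0) * u 0 * u 1 - κ * w ^ 2 * u 0 ^ 2) * hs
    have hKabs : |K (u 0)| ≤ 2 * g := by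
      have : |K (u 0)| = |s * K (u 0)| := by rw [abs_mul, hs1, one_mul]
      rw [this, abs_le]
      constructor <;> linarith
    have hmix : 2 * κ * K (u 0) * (u 0 * u 1) ≤ κ * w ^ 2 * u 0 ^ 2 / 2 + g / 2 * u 1 ^ 2 := by
      have h1 : 2 * κ * K (u 0) * (u 0 * u 1) ≤ 2 * κ * (2 * g) * (|u 0| * |u 1|) := by
        refine (le_abs_self _).trans ?_
        rw [abs_mul, abs_mul, abs_mul (u 0), abs_of_pos (by positivity : 0 < 2 * κ)]
        gcongr
      have h2 : 16 * κ * g * u 0 ^ 2 * κ ≤ w ^ 2 * u 0 ^ 2 * κ := by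
        have : κ * (16 * g) * (u 0 ^ 2 * κ) ≤ w ^ 2 * (u 0 ^ 2 * κ) := by gcongr
        linarith
      have h3 : 4 * κ * g * (|u 0| * |u 1|) ≤ 8 * κ * g * u 0 ^ 2 * κ + g / 2 * u 1 ^ 2 := by
        have := mul_nonneg hg.le (sq_nonneg (4 * κ * |u 0| - |u 1|))
        rw [← sq_abs (u 0), ← sq_abs (u 1)]
        nlinarith
      linarith
    have h4 : (4 * (s * K (u 0)) + κ) * u 1 ^ 2 ≤ -g * u 1 ^ 2 := by
      gcongr
      linarith
    rw [hder]
    simp only [hV]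
    have h5 : κ / 3 * (s * κ * (u 0 * u 1)) ≤ κ / 3 * ((u 1 ^ 2 + w ^ 2 * u 0 ^ 2) / 2) := by
      gcongr
    have h6 : κ * u 1 ^ 2 ≤ g * u 1 ^ 2 := by gcongr
    linarith

lemma continuous_nonreciprocity_sq (γ a b : ℝ) :
    Continuous fun x : ℝ => nonreciprocity γ a b (x ^ 2) := by
  unfold nonreciprocity
  fun_prop

lemma isAsymptoticallyStable_phaseField (a b : ℝ) {E γ : ℝ} (hE : 0 < E) (hγ : γ < 0) :
    IsAsymptoticallyStable (phaseField a b E γ) 0 := by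
  refine isAsymptoticallyStable_of_damped (K := fun x => nonreciprocity γ a b (x ^ 2)) (s := 1)
    (w := Real.sqrt (2 * E)) (by norm_num) (by positivity)
    (continuous_nonreciprocity_sq γ a b).continuousAt ?_ (fun u => ?_) (fun u => ?_)
  · simpa [nonreciprocity] using hγ
  · simp [phaseField]
  · rw [Real.sq_sqrt (by positivity)]
    simp [phaseField]

lemma isRepelling_phaseField (a b : ℝ) {E γ : ℝ} (hE : 0 < E) (hγ : 0 < γ) :
    IsRepelling (phaseField a b E γ) 0 := by
  refine isAsymptoticallyStable_of_damped (K := fun x => nonreciprocity γ a b (x ^ 2)) (s := -1)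
    (w := Real.sqrt (2 * E)) (by norm_num) (by positivity)
    (continuous_nonreciprocity_sq γ a b).continuousAt ?_ (fun u => ?_) (fun u => ?_)
  · simpa [nonreciprocity] using hγ
  · simp [phaseField]
  · rw [Real.sq_sqrt (by positivity)]
    simp [phaseField]

/-! ### Global solutions of bounded Lipschitz equations -/

open NNReal in
-- Because the field is bounded by `M`, Picard–Lindelöf applies on all of `[-(n+1), n+1]` with a
-- ball of radius `M (n+1)`. Uniqueness makes these solutions agree, and they are glued.
lemma exists_forall_hasDerivAt_of_lipschitz_of_bounded {h : ℝ → ℝ → ℝ} {K M : ℝ≥0}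
    (hlip : ∀ t, LipschitzWith K (h t)) (hcont : ∀ x, Continuous fun t => h t x)
    (hb : ∀ t x, |h t x| ≤ M) (x : ℝ) :
    ∃ R : ℝ → ℝ, R 0 = x ∧ ∀ t, HasDerivAt R (h t (R t)) t := by
  have hloc (n : ℕ) : ∃ α : ℝ → ℝ, α 0 = x ∧
      ∀ t ∈ Ioo (-(n + 1 : ℝ)) (n + 1), HasDerivAt α (h t (α t)) t := by
    have hn : (0 : ℝ) ≤ n + 1 := by positivity
    have hPL : IsPicardLindelof h (tmin := -(n + 1 : ℝ)) (tmax := n + 1)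
        ⟨0, neg_nonpos.2 hn, hn⟩ x (M * (n + 1)) 0 M K :=
      { lipschitzOnWith := fun t _ => (hlip t).lipschitzOnWith
        continuousOn := fun y _ => (hcont y).continuousOn
        norm_le := fun t _ y _ => hb t y
        mul_max_le := by simp }
    obtain ⟨α, h0, hα⟩ := hPL.exists_eq_forall_mem_Icc_hasDerivWithinAt₀
    exact ⟨α, h0, fun t ht => (hα t (Ioo_subset_Icc_self ht)).hasDerivAt
      (Icc_mem_nhds ht.1 ht.2)⟩
  choose α hα0 hα using hloc
  have huniq (m n : ℕ) (hmn : m ≤ n) (t : ℝ) (ht : t ∈ Ioo (-(m + 1 : ℝ)) (m + 1)) :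
      α m t = α n t := by
    have hmn' : (m : ℝ) ≤ n := by exact_mod_cast hmn
    have hm : (0 : ℝ) ≤ m := by positivity
    refine ODE_solution_unique_of_mem_Ioo (v := h) (K := K) (s := fun _ => univ) (t₀ := 0)
      (fun t _ => (hlip t).lipschitzOnWith) ⟨by linarith, by linarith⟩
      (fun t ht => ⟨hα m t ht, trivial⟩)
      (fun t ht => ⟨hα n t ⟨by linarith [ht.1], by linarith [ht.2]⟩, trivial⟩)
      ((hα0 m).trans (hα0 n).symm) ht
  -- The half-length `n + 1` puts `t` strictly inside the interval of index `⌈|t|⌉₊`. Near a given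
  -- time all these indices can be replaced by one fixed `N`.
  refine ⟨fun t => α ⌈|t|⌉₊ t, hα0 _, fun t => ?_⟩
  have hR (N : ℕ) (s : ℝ) (hs : |s| < N) : α ⌈|s|⌉₊ s = α N s := by
    refine huniq _ _ (Nat.ceil_le.2 hs.le) s ?_
    have := Nat.le_ceil |s|
    exact abs_lt.1 (by linarith)
  obtain ⟨N, hN⟩ := exists_nat_gt |t|
  have hev : ∀ᶠ s in 𝓝 t, α ⌈|s|⌉₊ s = α N s :=
    (continuous_abs.continuousAt.eventually_lt_const hN).mono fun s hs => hR N s hs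
  have := hα N t (abs_lt.1 (by linarith))
  rw [← hR N t hN] at this
  exact this.congr_of_eventuallyEq hev

/-! ### The polar form of the oscillator -/

/-- The coefficient `F` along the ray of angle `θ`, at radius `r`. -/
noncomputable def polarCoeff (a b γ θ r : ℝ) : ℝ := nonreciprocity γ a b ((r * Real.cos θ) ^ 2)

/-- The angular speed in the coordinates `ψ = r cos θ`, `v = - w r sin θ`. -/
noncomputable def angularSpeed (a b w γ θ r : ℝ) : ℝ :=
  w + 2 * polarCoeff a b γ θ r * (Real.sin θ * Real.cos θ)

/-- The logarithmic derivative of the radius with respect to the angle. -/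
noncomputable def radialRate (a b w γ θ r : ℝ) : ℝ :=
  2 * polarCoeff a b γ θ r * Real.sin θ ^ 2 / angularSpeed a b w γ θ r

/-- The projection of the line onto `[0, r₀]`. -/
def clampRadius (r₀ r : ℝ) : ℝ := max 0 (min r r₀)

/-- The right-hand side of the radial equation `dr/dθ`, cut off outside `[0, r₀]`. -/
noncomputable def polarField (a b w r₀ γ θ r : ℝ) : ℝ :=
  clampRadius r₀ r * radialRate a b w γ θ (clampRadius r₀ r)

/-- The radius `r₀` is so small that for `|γ| ≤ w / 8` orbits rotate on the disc of radius `r₀`. -/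
structure IsSmallRadius (a b w r₀ : ℝ) : Prop where
  a_pos : 0 < a
  b_pos : 0 < b
  w_pos : 0 < w
  pos : 0 < r₀
  le_speed : a * r₀ ^ 2 ≤ w / 16
  le_coeff : b * r₀ ^ 2 ≤ a

section Clamp

variable {r₀ : ℝ}

lemma clampRadius_nonneg (r₀ r : ℝ) : 0 ≤ clampRadius r₀ r := le_max_left _ _

lemma clampRadius_le (h : 0 ≤ r₀) (r : ℝ) : clampRadius r₀ r ≤ r₀ := max_le h (min_le_right _ _)

lemma clampRadius_mem (h : 0 ≤ r₀) (r : ℝ) : clampRadius r₀ r ∈ Icc 0 r₀ :=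
  ⟨clampRadius_nonneg r₀ r, clampRadius_le h r⟩

lemma clampRadius_of_mem {r : ℝ} (h : r ∈ Icc 0 r₀) : clampRadius r₀ r = r := by
  rw [clampRadius, min_eq_left h.2, max_eq_right h.1]

lemma clampRadius_le_self {r : ℝ} (h : 0 ≤ r) : clampRadius r₀ r ≤ r := max_le h (min_le_left _ _)

lemma clampRadius_zero (h : 0 ≤ r₀) : clampRadius r₀ 0 = 0 := clampRadius_of_mem ⟨le_rfl, h⟩

lemma clampRadius_pos (h : 0 < r₀) {r : ℝ} (hr : 0 < r) : 0 < clampRadius r₀ r :=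
  lt_max_of_lt_right (lt_min hr h)

lemma abs_clampRadius_sub_le (r₀ r s : ℝ) : |clampRadius r₀ r - clampRadius r₀ s| ≤ |r - s| := by
  unfold clampRadius
  grind

@[fun_prop]
lemma continuous_clampRadius (r₀ : ℝ) : Continuous (clampRadius r₀) := by
  unfold clampRadius
  fun_prop

end Clamp

@[fun_prop]
lemma continuous_polarCoeff_comp {X : Type*} [TopologicalSpace X] (a b γ : ℝ) {f g : X → ℝ}
    (hf : Continuous f) (hg : Continuous g) :
    Continuous fun x => polarCoeff a b γ (f x) (g x) := by
  unfold polarCoeff nonreciprocity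
  fun_prop

@[fun_prop]
lemma continuous_angularSpeed_comp {X : Type*} [TopologicalSpace X] (a b w γ : ℝ) {f g : X → ℝ}
    (hf : Continuous f) (hg : Continuous g) :
    Continuous fun x => angularSpeed a b w γ (f x) (g x) := by
  unfold angularSpeed
  fun_prop

lemma polarCoeff_add_two_pi (a b γ θ r : ℝ) :
    polarCoeff a b γ (θ + 2 * Real.pi) r = polarCoeff a b γ θ r := by
  simp [polarCoeff]

lemma angularSpeed_add_two_pi (a b w γ θ r : ℝ) :
    angularSpeed a b w γ (θ + 2 * Real.pi) r = angularSpeed a b w γ θ r := by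
  simp [angularSpeed, polarCoeff_add_two_pi]

lemma polarField_add_two_pi (a b w r₀ γ θ r : ℝ) :
    polarField a b w r₀ γ (θ + 2 * Real.pi) r = polarField a b w r₀ γ θ r := by
  simp [polarField, radialRate, angularSpeed_add_two_pi, polarCoeff_add_two_pi]

lemma polarField_of_mem {a b w r₀ γ θ r : ℝ} (hr : r ∈ Icc 0 r₀) :
    polarField a b w r₀ γ θ r = r * radialRate a b w γ θ r := by
  rw [polarField, clampRadius_of_mem hr]

lemma polarField_zero {r₀ : ℝ} (a b w γ θ : ℝ) (h : 0 ≤ r₀) : polarField a b w r₀ γ θ 0 = 0 := by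
  simp [polarField, clampRadius_zero h]

lemma radialRate_mul_angularSpeed {a b w γ θ r : ℝ} (h : angularSpeed a b w γ θ r ≠ 0) :
    radialRate a b w γ θ r * angularSpeed a b w γ θ r =
      2 * polarCoeff a b γ θ r * Real.sin θ ^ 2 := by
  rw [radialRate, div_mul_cancel₀ _ h]

/-! ### Bounds and Lipschitz estimates on the small disc -/

section Bounds

variable {a b w r₀ γ γ₁ γ₂ θ r r₁ r₂ : ℝ}

/-- On the small disc `bz ≤ a`, so `az - bz²` is between `0` and `az`. The lower bound forces
outward spiralling for `γ > 0`, the upper one inward spiralling for sufficiently negative `γ`. -/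
lemma IsSmallRadius.polarCoeff_bounds (h : IsSmallRadius a b w r₀) (hr : r ∈ Icc 0 r₀) :
    γ ≤ polarCoeff a b γ θ r ∧ polarCoeff a b γ θ r ≤ γ + a * r ^ 2 := by
  have hc : (r * Real.cos θ) ^ 2 ≤ r ^ 2 := by
    rw [mul_pow]
    exact mul_le_of_le_one_right (sq_nonneg _) (Real.cos_sq_le_one θ)
  have hr2 : r ^ 2 ≤ r₀ ^ 2 := by
    have := hr.1
    gcongr
    exact hr.2
  unfold polarCoeff nonreciprocity
  set z := (r * Real.cos θ) ^ 2
  have hz : 0 ≤ z := sq_nonneg _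
  have hbz : b * z ≤ a := by
    have := h.le_coeff
    have : b * z ≤ b * r₀ ^ 2 := mul_le_mul_of_nonneg_left (hc.trans hr2) h.b_pos.le
    linarith
  have h1 : b * z * z ≤ a * z := mul_le_mul_of_nonneg_right hbz hz
  have h2 : a * z ≤ a * r ^ 2 := mul_le_mul_of_nonneg_left hc h.a_pos.le
  have h3 : 0 ≤ b * z ^ 2 := mul_nonneg h.b_pos.le (sq_nonneg _)
  constructor <;> nlinarith

lemma IsSmallRadius.abs_polarCoeff_le (h : IsSmallRadius a b w r₀) (hγ : |γ| ≤ w / 8)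
    (hr : r ∈ Icc 0 r₀) : |polarCoeff a b γ θ r| ≤ w / 4 := by
  obtain ⟨h1, h2⟩ := h.polarCoeff_bounds (γ := γ) (θ := θ) hr
  have hr2 : a * r ^ 2 ≤ a * r₀ ^ 2 := by
    have := hr.1
    have := h.a_pos
    gcongr
    exact hr.2
  have := h.le_speed
  have := h.w_pos
  obtain ⟨h3, h4⟩ := abs_le.1 hγ
  rw [abs_le]
  constructor <;> linarith

lemma abs_sin_mul_cos_le (θ : ℝ) : |Real.sin θ * Real.cos θ| ≤ 1 / 2 := by
  rw [abs_le]
  have := Real.sin_sq_add_cos_sq θ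
  constructor <;> nlinarith [sq_nonneg (Real.sin θ + Real.cos θ),
    sq_nonneg (Real.sin θ - Real.cos θ)]

lemma abs_angularSpeed_sub_le (a b w γ θ r : ℝ) :
    |angularSpeed a b w γ θ r - w| ≤ |polarCoeff a b γ θ r| := by
  have h1 : |polarCoeff a b γ θ r| * |Real.sin θ * Real.cos θ| ≤
      |polarCoeff a b γ θ r| * (1 / 2) := by
    gcongr
    exact abs_sin_mul_cos_le θ
  rw [angularSpeed, add_sub_cancel_left, abs_mul, abs_mul, abs_two]
  linarith

lemma IsSmallRadius.angularSpeed_mem (h : IsSmallRadius a b w r₀) (hγ : |γ| ≤ w / 8)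
    (hr : r ∈ Icc 0 r₀) : angularSpeed a b w γ θ r ∈ Icc (3 * w / 4) (5 * w / 4) := by
  have := (abs_angularSpeed_sub_le a b w γ θ r).trans (h.abs_polarCoeff_le hγ hr)
  obtain ⟨h1, h2⟩ := abs_le.1 this
  constructor <;> linarith

lemma IsSmallRadius.angularSpeed_pos (h : IsSmallRadius a b w r₀) (hγ : |γ| ≤ w / 8)
    (hr : r ∈ Icc 0 r₀) : 0 < angularSpeed a b w γ θ r :=
  lt_of_lt_of_le (by linarith [h.w_pos]) (h.angularSpeed_mem hγ hr).1

lemma IsSmallRadius.abs_radialRate_le (h : IsSmallRadius a b w r₀) (hγ : |γ| ≤ w / 8)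
    (hr : r ∈ Icc 0 r₀) : |radialRate a b w γ θ r| ≤ 1 := by
  have hq := h.angularSpeed_pos (θ := θ) hγ hr
  rw [radialRate, abs_div, abs_of_pos hq, div_le_one hq, abs_mul, abs_mul, abs_two,
    abs_of_nonneg (sq_nonneg (Real.sin θ))]
  have h1 := h.abs_polarCoeff_le (θ := θ) hγ hr
  have h2 := (h.angularSpeed_mem (θ := θ) hγ hr).1
  have h3 : 2 * |polarCoeff a b γ θ r| * Real.sin θ ^ 2 ≤ 2 * |polarCoeff a b γ θ r| * 1 := by
    gcongr
    exact Real.sin_sq_le_one θ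
  linarith [h.w_pos]

/-- The coefficient of the difference of the radii in the difference of two radial fields. -/
noncomputable def radialSlope (a b w γ₁ γ₂ θ r₁ r₂ : ℝ) : ℝ :=
  radialRate a b w γ₂ θ r₂ + r₁ * (2 * w * Real.sin θ ^ 2 * (Real.cos θ ^ 2 * (r₁ + r₂) *
    (a - b * ((r₁ ^ 2 + r₂ ^ 2) * Real.cos θ ^ 2)))) /
      (angularSpeed a b w γ₁ θ r₁ * angularSpeed a b w γ₂ θ r₂)

/-- The coefficient of the difference of the parameters in the difference of two radial fields. -/
noncomputable def parameterSlope (a b w γ₁ γ₂ θ r₁ r₂ : ℝ) : ℝ :=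
  r₁ * (2 * w * Real.sin θ ^ 2) / (angularSpeed a b w γ₁ θ r₁ * angularSpeed a b w γ₂ θ r₂)

/-- An exact difference-quotient identity, used both for Lipschitz bounds and for monotonicity in
the parameter. The map `F ↦ F / (w + 2F sin θ cos θ)` has the difference `w (F₂ - F₁) / (q₁ q₂)`,
with `q₁, q₂` the angular speeds, and `F₂ - F₁` factors explicitly. -/
lemma mul_radialRate_sub_mul_radialRate (h₁ : angularSpeed a b w γ₁ θ r₁ ≠ 0)
    (h₂ : angularSpeed a b w γ₂ θ r₂ ≠ 0) :
    r₂ * radialRate a b w γ₂ θ r₂ - r₁ * radialRate a b w γ₁ θ r₁ =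
      (r₂ - r₁) * radialSlope a b w γ₁ γ₂ θ r₁ r₂ +
        (γ₂ - γ₁) * parameterSlope a b w γ₁ γ₂ θ r₁ r₂ := by
  have hF : polarCoeff a b γ₂ θ r₂ - polarCoeff a b γ₁ θ r₁ = (γ₂ - γ₁) +
      (r₂ - r₁) * (Real.cos θ ^ 2 * (r₁ + r₂) *
        (a - b * ((r₁ ^ 2 + r₂ ^ 2) * Real.cos θ ^ 2))) := by
    unfold polarCoeff nonreciprocity
    ring
  have hG : radialRate a b w γ₂ θ r₂ - radialRate a b w γ₁ θ r₁ = 2 * w * Real.sin θ ^ 2 *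
      (polarCoeff a b γ₂ θ r₂ - polarCoeff a b γ₁ θ r₁) /
        (angularSpeed a b w γ₁ θ r₁ * angularSpeed a b w γ₂ θ r₂) := by
    unfold radialRate
    rw [div_sub_div _ _ h₂ h₁, mul_comm (angularSpeed a b w γ₁ θ r₁)]
    congr 1
    unfold angularSpeed
    ring
  have : r₂ * radialRate a b w γ₂ θ r₂ - r₁ * radialRate a b w γ₁ θ r₁ =
      (r₂ - r₁) * radialRate a b w γ₂ θ r₂ +
        r₁ * (radialRate a b w γ₂ θ r₂ - radialRate a b w γ₁ θ r₁) := by ring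
  rw [this, hG, hF, radialSlope, parameterSlope]
  ring

lemma IsSmallRadius.le_angularSpeed_mul_angularSpeed (h : IsSmallRadius a b w r₀)
    (hγ₁ : |γ₁| ≤ w / 8) (hγ₂ : |γ₂| ≤ w / 8) (hr₁ : r₁ ∈ Icc 0 r₀) (hr₂ : r₂ ∈ Icc 0 r₀) :
    9 * w ^ 2 / 16 ≤ angularSpeed a b w γ₁ θ r₁ * angularSpeed a b w γ₂ θ r₂ := by
  have hw := h.w_pos
  calc 9 * w ^ 2 / 16 = 3 * w / 4 * (3 * w / 4) := by ring
    _ ≤ _ := mul_le_mul (h.angularSpeed_mem hγ₁ hr₁).1 (h.angularSpeed_mem hγ₂ hr₂).1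
      (by positivity) (h.angularSpeed_pos hγ₁ hr₁).le

lemma IsSmallRadius.abs_radialSlope_le (h : IsSmallRadius a b w r₀) (hγ₁ : |γ₁| ≤ w / 8)
    (hγ₂ : |γ₂| ≤ w / 8) (hr₁ : r₁ ∈ Icc 0 r₀) (hr₂ : r₂ ∈ Icc 0 r₀) :
    |radialSlope a b w γ₁ γ₂ θ r₁ r₂| ≤ 2 := by
  have hw := h.w_pos
  have ha := h.a_pos
  have hb := h.b_pos
  have hr := h.pos
  have hs := Real.sin_sq_le_one θ
  have hc := Real.cos_sq_le_one θ
  have h0₁ := hr₁.1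
  have h0₂ := hr₂.1
  have hq := h.le_angularSpeed_mul_angularSpeed (θ := θ) hγ₁ hγ₂ hr₁ hr₂
  have hbr : |a - b * ((r₁ ^ 2 + r₂ ^ 2) * Real.cos θ ^ 2)| ≤ a := by
    have h1 : b * ((r₁ ^ 2 + r₂ ^ 2) * Real.cos θ ^ 2) ≤ b * ((r₀ ^ 2 + r₀ ^ 2) * 1) := by
      gcongr
      exacts [hr₁.2, hr₂.2]
    have h2 : 0 ≤ b * ((r₁ ^ 2 + r₂ ^ 2) * Real.cos θ ^ 2) := by positivity
    have := h.le_coeff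
    rw [abs_le]
    constructor <;> linarith
  have hnum : |r₁ * (2 * w * Real.sin θ ^ 2 * (Real.cos θ ^ 2 * (r₁ + r₂) *
      (a - b * ((r₁ ^ 2 + r₂ ^ 2) * Real.cos θ ^ 2))))| ≤ w ^ 2 / 4 := by
    rw [abs_mul, abs_mul, abs_mul (Real.cos θ ^ 2 * (r₁ + r₂)), abs_of_nonneg h0₁,
      abs_of_nonneg (by positivity : 0 ≤ 2 * w * Real.sin θ ^ 2),
      abs_of_nonneg (by positivity : 0 ≤ Real.cos θ ^ 2 * (r₁ + r₂))]
    calc _ ≤ r₀ * (2 * w * 1 * (1 * (r₀ + r₀) * a)) := by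
          gcongr
          exacts [hr₁.2, hr₁.2, hr₂.2]
      _ = 4 * w * (a * r₀ ^ 2) := by ring
      _ ≤ 4 * w * (w / 16) := by
          gcongr
          exact h.le_speed
      _ = w ^ 2 / 4 := by ring
  have hquot : |r₁ * (2 * w * Real.sin θ ^ 2 * (Real.cos θ ^ 2 * (r₁ + r₂) *
      (a - b * ((r₁ ^ 2 + r₂ ^ 2) * Real.cos θ ^ 2)))) /
      (angularSpeed a b w γ₁ θ r₁ * angularSpeed a b w γ₂ θ r₂)| ≤ 1 := by
    rw [abs_div, div_le_one (lt_of_lt_of_le (by positivity) (hq.trans (le_abs_self _)))]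
    refine hnum.trans (le_trans ?_ (hq.trans (le_abs_self _)))
    nlinarith
  exact (abs_add_le _ _).trans (by linarith [h.abs_radialRate_le (θ := θ) hγ₂ hr₂])

lemma IsSmallRadius.parameterSlope_mem (h : IsSmallRadius a b w r₀) (hγ₁ : |γ₁| ≤ w / 8)
    (hγ₂ : |γ₂| ≤ w / 8) (hr₁ : r₁ ∈ Icc 0 r₀) (hr₂ : r₂ ∈ Icc 0 r₀) :
    parameterSlope a b w γ₁ γ₂ θ r₁ r₂ ∈ Icc 0 (4 * r₀ / w) := by
  have hw := h.w_pos
  have h0 := hr₁.1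
  have hq := h.le_angularSpeed_mul_angularSpeed (θ := θ) hγ₁ hγ₂ hr₁ hr₂
  have hq0 : 0 < angularSpeed a b w γ₁ θ r₁ * angularSpeed a b w γ₂ θ r₂ :=
    lt_of_lt_of_le (by positivity) hq
  refine ⟨by unfold parameterSlope; positivity, ?_⟩
  rw [parameterSlope, div_le_iff₀ hq0]
  calc r₁ * (2 * w * Real.sin θ ^ 2) ≤ r₀ * (2 * w * 1) := by
        have := h.pos
        gcongr
        exacts [hr₁.2, Real.sin_sq_le_one θ]
    _ ≤ 4 * r₀ / w * (9 * w ^ 2 / 16) := by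
        have : 4 * r₀ / w * (9 * w ^ 2 / 16) = r₀ * (2 * w * 1) * (9 / 8) := by
          field_simp
          ring
        rw [this]
        have := h.pos
        exact le_mul_of_one_le_right (by positivity) (by norm_num)
    _ ≤ _ := by
        have := h.pos
        gcongr

lemma IsSmallRadius.parameterSlope_pos (h : IsSmallRadius a b w r₀) (hγ₁ : |γ₁| ≤ w / 8)
    (hγ₂ : |γ₂| ≤ w / 8) (hr₁ : r₁ ∈ Icc 0 r₀) (hr₂ : r₂ ∈ Icc 0 r₀) (hr₁0 : 0 < r₁)
    (hθ : Real.sin θ ≠ 0) : 0 < parameterSlope a b w γ₁ γ₂ θ r₁ r₂ := by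
  have hw := h.w_pos
  have hq₁ := h.angularSpeed_pos (θ := θ) hγ₁ hr₁
  have hq₂ := h.angularSpeed_pos (θ := θ) hγ₂ hr₂
  unfold parameterSlope
  positivity

lemma IsSmallRadius.abs_polarField_sub_le (h : IsSmallRadius a b w r₀) (hγ₁ : |γ₁| ≤ w / 8)
    (hγ₂ : |γ₂| ≤ w / 8) (θ r₁ r₂ : ℝ) :
    |polarField a b w r₀ γ₂ θ r₂ - polarField a b w r₀ γ₁ θ r₁| ≤
      2 * |r₂ - r₁| + 4 * r₀ / w * |γ₂ - γ₁| := by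
  have m₁ := clampRadius_mem h.pos.le r₁
  have m₂ := clampRadius_mem h.pos.le r₂
  have hB := h.abs_radialSlope_le (θ := θ) hγ₁ hγ₂ m₁ m₂
  have hC := h.parameterSlope_mem (θ := θ) hγ₁ hγ₂ m₁ m₂
  unfold polarField
  rw [mul_radialRate_sub_mul_radialRate (h.angularSpeed_pos hγ₁ m₁).ne'
    (h.angularSpeed_pos hγ₂ m₂).ne']
  refine (abs_add_le _ _).trans ?_
  rw [abs_mul, abs_mul, abs_of_nonneg hC.1, mul_comm, mul_comm |γ₂ - γ₁|]
  exact add_le_add (mul_le_mul hB (abs_clampRadius_sub_le _ _ _) (abs_nonneg _) zero_le_two)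
    (mul_le_mul_of_nonneg_right hC.2 (abs_nonneg _))

lemma IsSmallRadius.lipschitzWith_polarField (h : IsSmallRadius a b w r₀) (hγ : |γ| ≤ w / 8)
    (θ : ℝ) : LipschitzWith 2 (polarField a b w r₀ γ θ) := by
  refine LipschitzWith.of_dist_le_mul fun x y => ?_
  have := h.abs_polarField_sub_le hγ hγ θ y x
  simpa [Real.dist_eq] using this

lemma IsSmallRadius.abs_polarField_le (h : IsSmallRadius a b w r₀) (hγ : |γ| ≤ w / 8)
    (θ r : ℝ) : |polarField a b w r₀ γ θ r| ≤ clampRadius r₀ r := by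
  rw [polarField, abs_mul, abs_of_nonneg (clampRadius_nonneg _ _)]
  exact mul_le_of_le_one_right (clampRadius_nonneg _ _)
    (h.abs_radialRate_le hγ (clampRadius_mem h.pos.le r))

lemma IsSmallRadius.continuous_polarField (h : IsSmallRadius a b w r₀) (hγ : |γ| ≤ w / 8)
    (r : ℝ) : Continuous fun θ => polarField a b w r₀ γ θ r := by
  unfold polarField radialRate
  exact continuous_const.mul (Continuous.div (by fun_prop) (by fun_prop)
    fun θ => (h.angularSpeed_pos hγ (clampRadius_mem h.pos.le r)).ne')

end Bounds

/-! ### Solutions of the radial equation -/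

/-- `R` solves the radial equation `dR/dθ = polarField θ R`. -/
def IsPolarSolution (a b w r₀ γ : ℝ) (R : ℝ → ℝ) : Prop :=
  ∀ θ, HasDerivAt R (polarField a b w r₀ γ θ (R θ)) θ

/-- The radial field carries a factor `sin² θ`, so strict signs fail at `0`, `π`, `2π`; splitting at
`π` leaves these only as endpoints. -/
lemma lt_of_hasDerivAt_pos_of_sin_ne_zero {f f' : ℝ → ℝ} (hf : ∀ θ, HasDerivAt f (f' θ) θ)
    (hf' : ∀ θ ∈ Icc 0 (2 * Real.pi), Real.sin θ ≠ 0 → 0 < f' θ) : f 0 < f (2 * Real.pi) := by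
  have hπ := Real.pi_pos
  have hcont : Continuous f := continuous_iff_continuousAt.2 fun θ => (hf θ).continuousAt
  have h1 : f 0 < f Real.pi := by
    refine strictMonoOn_of_deriv_pos (convex_Icc 0 Real.pi) hcont.continuousOn (fun θ hθ => ?_)
      ⟨le_rfl, hπ.le⟩ ⟨hπ.le, le_rfl⟩ hπ
    rw [interior_Icc] at hθ
    rw [(hf θ).deriv]
    exact hf' θ ⟨hθ.1.le, by linarith [hθ.2]⟩ (Real.sin_pos_of_pos_of_lt_pi hθ.1 hθ.2).ne'
  have h2 : f Real.pi < f (2 * Real.pi) := by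
    refine strictMonoOn_of_deriv_pos (convex_Icc Real.pi (2 * Real.pi)) hcont.continuousOn
      (fun θ hθ => ?_) ⟨le_rfl, by linarith⟩ ⟨by linarith, le_rfl⟩ (by linarith)
    rw [interior_Icc] at hθ
    rw [(hf θ).deriv]
    refine hf' θ ⟨by linarith [hθ.1], hθ.2.le⟩ ?_
    have := Real.sin_pos_of_pos_of_lt_pi (x := θ - Real.pi) (by linarith [hθ.1])
      (by linarith [hθ.2])
    rw [Real.sin_sub_pi] at this
    linarith
  exact h1.trans h2

section Solutions

variable {a b w r₀ γ γ₁ γ₂ : ℝ} {R R₁ R₂ : ℝ → ℝ}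

lemma IsPolarSolution.continuous (hR : IsPolarSolution a b w r₀ γ R) : Continuous R :=
  continuous_iff_continuousAt.2 fun θ => (hR θ).continuousAt

lemma IsSmallRadius.exists_isPolarSolution (h : IsSmallRadius a b w r₀) (hγ : |γ| ≤ w / 8)
    (x : ℝ) : ∃ R, R 0 = x ∧ IsPolarSolution a b w r₀ γ R :=
  exists_forall_hasDerivAt_of_lipschitz_of_bounded (M := ⟨r₀, h.pos.le⟩)
    (h.lipschitzWith_polarField hγ) (h.continuous_polarField hγ)
    (fun θ r => (h.abs_polarField_le hγ θ r).trans (clampRadius_le h.pos.le r)) x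

lemma IsPolarSolution.eq (h : IsSmallRadius a b w r₀) (hγ : |γ| ≤ w / 8)
    (h₁ : IsPolarSolution a b w r₀ γ R₁) (h₂ : IsPolarSolution a b w r₀ γ R₂) {θ₀ : ℝ}
    (h0 : R₁ θ₀ = R₂ θ₀) : R₁ = R₂ :=
  ODE_solution_unique_univ (s := fun _ => univ)
    (fun θ => (h.lipschitzWith_polarField hγ θ).lipschitzOnWith)
    (fun θ => ⟨h₁ θ, trivial⟩) (fun θ => ⟨h₂ θ, trivial⟩) h0

/-- Two solutions that exchange their order, forwards or backwards in the angle, would meet and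
hence coincide. -/
lemma IsPolarSolution.lt (h : IsSmallRadius a b w r₀) (hγ : |γ| ≤ w / 8)
    (h₁ : IsPolarSolution a b w r₀ γ R₁) (h₂ : IsPolarSolution a b w r₀ γ R₂)
    {θ₀ : ℝ} (h0 : R₁ θ₀ < R₂ θ₀) (θ : ℝ) : R₁ θ < R₂ θ := by
  by_contra! hle
  have hc : ContinuousOn (fun t => R₂ t - R₁ t) (uIcc θ₀ θ) :=
    (h₂.continuous.sub h₁.continuous).continuousOn
  have hmem : (0 : ℝ) ∈ uIcc (R₂ θ₀ - R₁ θ₀) (R₂ θ - R₁ θ) :=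
    mem_uIcc.2 (Or.inr ⟨by linarith, by linarith⟩)
  obtain ⟨t, -, ht⟩ := intermediate_value_uIcc hc hmem
  have := h₁.eq h hγ h₂ (θ₀ := t) (sub_eq_zero.1 ht).symm
  rw [this] at h0
  exact h0.false

lemma isPolarSolution_zero (h : 0 ≤ r₀) : IsPolarSolution a b w r₀ γ fun _ => 0 := fun θ => by
  rw [polarField_zero a b w γ θ h]
  exact hasDerivAt_const θ 0

lemma IsPolarSolution.pos (h : IsSmallRadius a b w r₀) (hγ : |γ| ≤ w / 8)
    (hR : IsPolarSolution a b w r₀ γ R) (h0 : 0 < R 0) (θ : ℝ) : 0 < R θ :=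
  (isPolarSolution_zero h.pos.le).lt h hγ hR h0 θ

/-- The logarithmic growth rate is at most 1. Over one turn the radius grows by at most `e^{2π}`, so
the cut-off is inactive there once `R 0 * e^{2π} ≤ r₀`. -/
lemma IsPolarSolution.le_mul_exp (h : IsSmallRadius a b w r₀) (hγ : |γ| ≤ w / 8)
    (hR : IsPolarSolution a b w r₀ γ R) (h0 : 0 < R 0) {θ : ℝ} (hθ : 0 ≤ θ) :
    R θ ≤ R 0 * Real.exp θ := by
  have hd (t : ℝ) : HasDerivAt (fun t => R t * Real.exp (-t))
      (polarField a b w r₀ γ t (R t) * Real.exp (-t) + R t * (Real.exp (-t) * -1)) t :=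
    (hR t).mul (hasDerivAt_neg t).exp
  have hanti : Antitone fun t => R t * Real.exp (-t) := by
    refine antitone_of_hasDerivAt_nonpos hd fun t => ?_
    have h1 := (le_abs_self _).trans ((h.abs_polarField_le hγ t (R t)).trans
      (clampRadius_le_self (hR.pos h hγ h0 t).le))
    simp only [Pi.zero_apply]
    nlinarith [Real.exp_pos (-t)]
  have h1 := hanti hθ
  simp only [neg_zero, Real.exp_zero, mul_one, Real.exp_neg] at h1
  rwa [← div_eq_mul_inv, div_le_iff₀ (Real.exp_pos _)] at h1

lemma IsPolarSolution.le_mul_exp_two_pi (h : IsSmallRadius a b w r₀) (hγ : |γ| ≤ w / 8)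
    (hR : IsPolarSolution a b w r₀ γ R) (h0 : 0 < R 0) {θ : ℝ} (hθ : θ ∈ Icc 0 (2 * Real.pi)) :
    R θ ≤ R 0 * Real.exp (2 * Real.pi) := by
  refine (hR.le_mul_exp h hγ h0 hθ.1).trans ?_
  gcongr
  exact hθ.2

lemma IsPolarSolution.mem_Icc (h : IsSmallRadius a b w r₀) (hγ : |γ| ≤ w / 8)
    (hR : IsPolarSolution a b w r₀ γ R) (h0 : 0 < R 0) (hr : R 0 * Real.exp (2 * Real.pi) ≤ r₀)
    {θ : ℝ} (hθ : θ ∈ Icc 0 (2 * Real.pi)) : R θ ∈ Icc 0 r₀ :=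
  ⟨(hR.pos h hγ h0 θ).le, (hR.le_mul_exp_two_pi h hγ h0 hθ).trans hr⟩

/-- Grönwall's inequality: `R₂` solves the equation for `γ₁` up to an error `4 r₀ / w * |γ₁ - γ₂|`,
and the Lipschitz constant 2 over an angle `2π` gives `e^{4π}`. -/
lemma IsPolarSolution.abs_sub_le (h : IsSmallRadius a b w r₀) (hγ₁ : |γ₁| ≤ w / 8)
    (hγ₂ : |γ₂| ≤ w / 8) (h₁ : IsPolarSolution a b w r₀ γ₁ R₁)
    (h₂ : IsPolarSolution a b w r₀ γ₂ R₂) {θ : ℝ} (hθ : θ ∈ Icc 0 (2 * Real.pi)) :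
    |R₁ θ - R₂ θ| ≤
      (|R₁ 0 - R₂ 0| + 4 * r₀ / w * |γ₁ - γ₂|) * Real.exp (4 * Real.pi) := by
  have hw := h.w_pos
  have hr := h.pos
  have hG := dist_le_of_approx_trajectories_ODE (v := polarField a b w r₀ γ₁) (K := 2)
    (εf := 0) (εg := 4 * r₀ / w * |γ₁ - γ₂|) (a := 0) (b := 2 * Real.pi) (δ := |R₁ 0 - R₂ 0|)
    (h.lipschitzWith_polarField hγ₁) h₁.continuous.continuousOn
    (fun t _ => (h₁ t).hasDerivWithinAt) (fun t _ => (dist_self _).le)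
    h₂.continuous.continuousOn (fun t _ => (h₂ t).hasDerivWithinAt)
    (fun t _ => by
      have := h.abs_polarField_sub_le hγ₁ hγ₂ t (R₂ t) (R₂ t)
      rw [Real.dist_eq, abs_sub_comm γ₁]
      simpa using this) le_rfl θ hθ
  rw [Real.dist_eq, zero_add, sub_zero] at hG
  refine hG.trans ((gronwallBound_mono (abs_nonneg _) (by positivity) (by positivity) hθ.2).trans ?_)
  rw [gronwallBound_of_K_ne_0 (by norm_num)]
  have h2 : ((2 : NNReal) : ℝ) * (2 * Real.pi) = 4 * Real.pi := by push_cast; ring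
  simp only [h2]
  have h3 : 4 * r₀ / w * |γ₁ - γ₂| / ((2 : NNReal) : ℝ) * (Real.exp (4 * Real.pi) - 1) ≤
      4 * r₀ / w * |γ₁ - γ₂| * Real.exp (4 * Real.pi) := by
    have h4 : 0 ≤ Real.exp (4 * Real.pi) - 1 := by
      have := Real.one_le_exp (by positivity : 0 ≤ 4 * Real.pi)
      linarith
    refine mul_le_mul (div_le_self (by positivity) (by norm_num)) (by linarith) h4 (by positivity)
  linarith

lemma IsPolarSolution.lt_of_pos (h : IsSmallRadius a b w r₀) (hγ : |γ| ≤ w / 8)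
    (hR : IsPolarSolution a b w r₀ γ R) (h0 : 0 < R 0) (hγ0 : 0 < γ) : R 0 < R (2 * Real.pi) := by
  refine lt_of_hasDerivAt_pos_of_sin_ne_zero hR fun θ _ hs => ?_
  have m := clampRadius_mem h.pos.le (R θ)
  have hq := h.angularSpeed_pos (θ := θ) hγ m
  have hF := hγ0.trans_le (h.polarCoeff_bounds (γ := γ) (θ := θ) m).1
  have hp := clampRadius_pos h.pos (hR.pos h hγ h0 θ)
  unfold polarField radialRate
  positivity

lemma IsPolarSolution.lt_of_neg (h : IsSmallRadius a b w r₀) (hγ : |γ| ≤ w / 8)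
    (hR : IsPolarSolution a b w r₀ γ R) (h0 : 0 < R 0)
    (hγ0 : a * (R 0 * Real.exp (2 * Real.pi)) ^ 2 < -γ) : R (2 * Real.pi) < R 0 := by
  have := lt_of_hasDerivAt_pos_of_sin_ne_zero (fun θ => (hR θ).neg) fun θ hθ hs => ?_
  · simpa using this
  have m := clampRadius_mem h.pos.le (R θ)
  have hq := h.angularSpeed_pos (θ := θ) hγ m
  have hF := (h.polarCoeff_bounds (γ := γ) (θ := θ) m).2
  have hRp := hR.pos h hγ h0 θ
  have hp := clampRadius_pos h.pos hRp
  have hle : a * clampRadius r₀ (R θ) ^ 2 ≤ a * (R 0 * Real.exp (2 * Real.pi)) ^ 2 := by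
    have := h.a_pos
    gcongr
    exact (clampRadius_le_self hRp.le).trans (hR.le_mul_exp_two_pi h hγ h0 hθ)
  have hF' : 0 < -polarCoeff a b γ θ (clampRadius r₀ (R θ)) := by linarith
  have : -polarField a b w r₀ γ θ (R θ) = clampRadius r₀ (R θ) *
      (2 * -polarCoeff a b γ θ (clampRadius r₀ (R θ)) * Real.sin θ ^ 2 /
        angularSpeed a b w γ θ (clampRadius r₀ (R θ))) := by
    unfold polarField radialRate
    ring
  rw [this]
  positivity

/-- The radius after one turn is strictly increasing in the parameter. -/
lemma IsPolarSolution.lt_of_lt (h : IsSmallRadius a b w r₀) (hγ₁ : |γ₁| ≤ w / 8)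
    (hγ₂ : |γ₂| ≤ w / 8) (hlt : γ₁ < γ₂) (h₁ : IsPolarSolution a b w r₀ γ₁ R₁)
    (h₂ : IsPolarSolution a b w r₀ γ₂ R₂) (h0 : 0 < R₁ 0) (heq : R₁ 0 = R₂ 0)
    (hr : R₁ 0 * Real.exp (2 * Real.pi) ≤ r₀) : R₁ (2 * Real.pi) < R₂ (2 * Real.pi) := by
  -- The difference `D = R₂ - R₁` satisfies `D' = B D + (γ₂ - γ₁) C` with `C > 0` wherever `sin θ ≠
  -- 0`. Multiplied by the integrating factor `e^{-∫B}` it increases strictly from 0. Clamping in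
  -- `B` keeps it continuous on the whole line.
  set B : ℝ → ℝ := fun θ =>
    radialSlope a b w γ₁ γ₂ θ (clampRadius r₀ (R₁ θ)) (clampRadius r₀ (R₂ θ)) with hB
  have c₁ := h₁.continuous
  have c₂ := h₂.continuous
  have q₁ (θ : ℝ) := h.angularSpeed_pos (θ := θ) hγ₁ (clampRadius_mem h.pos.le (R₁ θ))
  have q₂ (θ : ℝ) := h.angularSpeed_pos (θ := θ) hγ₂ (clampRadius_mem h.pos.le (R₂ θ))
  have hBc : Continuous B := by
    simp only [hB, radialSlope, radialRate]
    refine (Continuous.div ?_ ?_ fun θ => (q₂ θ).ne').add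
      (Continuous.div ?_ ?_ fun θ => (mul_pos (q₁ θ) (q₂ θ)).ne') <;> fun_prop
  have hI (θ : ℝ) : HasDerivAt (fun t => ∫ s in (0 : ℝ)..t, B s) (B θ) θ :=
    intervalIntegral.integral_hasDerivAt_right (hBc.intervalIntegrable _ _)
      (hBc.stronglyMeasurableAtFilter _ _) hBc.continuousAt
  have hd (θ : ℝ) := ((h₂ θ).sub (h₁ θ)).mul (hI θ).neg.exp
  have key := lt_of_hasDerivAt_pos_of_sin_ne_zero hd fun θ hθ hs => ?_
  · simp only [Pi.sub_apply, Pi.mul_apply, heq, sub_self, zero_mul] at key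
    have := pos_of_mul_pos_left key (Real.exp_pos _).le
    linarith
  have m₁ := h₁.mem_Icc h hγ₁ h0 hr hθ
  have m₂ := h₂.mem_Icc h hγ₂ (heq ▸ h0) (heq ▸ hr) hθ
  have hC := h.parameterSlope_pos (θ := θ) hγ₁ hγ₂ m₁ m₂ (h₁.pos h hγ₁ h0 θ) hs
  have hq₁ := h.angularSpeed_pos (θ := θ) hγ₁ m₁
  have hq₂ := h.angularSpeed_pos (θ := θ) hγ₂ m₂
  rw [polarField_of_mem m₁, polarField_of_mem m₂,
    mul_radialRate_sub_mul_radialRate hq₁.ne' hq₂.ne']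
  have hBθ : B θ = radialSlope a b w γ₁ γ₂ θ (R₁ θ) (R₂ θ) := by
    simp only [hB, clampRadius_of_mem m₁, clampRadius_of_mem m₂]
  rw [hBθ]
  have : 0 < (γ₂ - γ₁) * parameterSlope a b w γ₁ γ₂ θ (R₁ θ) (R₂ θ) *
      Real.exp (-∫ s in (0 : ℝ)..θ, B s) :=
    mul_pos (mul_pos (sub_pos.2 hlt) hC) (Real.exp_pos _)
  simp only [Pi.sub_apply, Pi.neg_apply]
  linarith

lemma IsPolarSolution.comp_add_two_pi (hR : IsPolarSolution a b w r₀ γ R) :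
    IsPolarSolution a b w r₀ γ fun θ => R (θ + 2 * Real.pi) := fun θ => by
  have := (hR (θ + 2 * Real.pi)).comp_add_const θ (2 * Real.pi)
  rwa [polarField_add_two_pi] at this

lemma IsPolarSolution.periodic (h : IsSmallRadius a b w r₀) (hγ : |γ| ≤ w / 8)
    (hR : IsPolarSolution a b w r₀ γ R) (h0 : R (2 * Real.pi) = R 0) :
    Function.Periodic R (2 * Real.pi) := fun θ =>
  congrFun (hR.comp_add_two_pi.eq h hγ hR (θ₀ := 0) (by simpa using h0)) θ

/-- The shift of `R` by `2π` is again a solution. If it starts strictly above or below `R` it stays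
so, and the radii after successive turns are strictly monotone and never return. -/
lemma IsPolarSolution.eq_of_iterate_eq (h : IsSmallRadius a b w r₀) (hγ : |γ| ≤ w / 8)
    (hR : IsPolarSolution a b w r₀ γ R) {k : ℕ} (hk : 0 < k) (h0 : R (k * (2 * Real.pi)) = R 0) :
    R (2 * Real.pi) = R 0 := by
  have hstep (n : ℕ) : ((n + 1 : ℕ) : ℝ) * (2 * Real.pi) = n * (2 * Real.pi) + 2 * Real.pi := by
    push_cast
    ring
  rcases lt_trichotomy (R (2 * Real.pi)) (R 0) with hlt | heq | hlt
  · have := hR.comp_add_two_pi.lt h hγ hR (θ₀ := 0) (by simpa using hlt)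
    have hanti : StrictAnti fun n : ℕ => R (n * (2 * Real.pi)) :=
      strictAnti_nat_of_succ_lt fun n => by
        rw [hstep]
        exact this _
    have := hanti hk
    simp [h0] at this
  · exact heq
  · have := hR.lt h hγ hR.comp_add_two_pi (θ₀ := 0) (by simpa using hlt)
    have hmono : StrictMono fun n : ℕ => R (n * (2 * Real.pi)) :=
      strictMono_nat_of_lt_succ fun n => by
        rw [hstep]
        exact this _
    have := hmono hk
    simp [h0] at this

end Solutions

/-! ### The parameter of the closed orbit of given amplitude -/

section Parameter

variable {a b w r₀ γ γ₁ γ₂ : ℝ} {R R₁ R₂ : ℝ → ℝ}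

lemma IsPolarSolution.parameter_unique (h : IsSmallRadius a b w r₀) (hγ₁ : |γ₁| ≤ w / 8)
    (hγ₂ : |γ₂| ≤ w / 8) (h₁ : IsPolarSolution a b w r₀ γ₁ R₁)
    (h₂ : IsPolarSolution a b w r₀ γ₂ R₂) (h0 : 0 < R₁ 0) (heq : R₁ 0 = R₂ 0)
    (hr : R₁ 0 * Real.exp (2 * Real.pi) ≤ r₀) (hc : R₁ (2 * Real.pi) = R₂ (2 * Real.pi)) :
    γ₁ = γ₂ := by
  rcases lt_trichotomy γ₁ γ₂ with hlt | heq' | hlt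
  · exact absurd hc (h₁.lt_of_lt h hγ₁ hγ₂ hlt h₂ h0 heq hr).ne
  · exact heq'
  · exact absurd hc (h₂.lt_of_lt h hγ₂ hγ₁ hlt h₁ (heq ▸ h0) heq.symm (heq ▸ hr)).ne'

lemma IsPolarSolution.abs_parameter_le (h : IsSmallRadius a b w r₀) (hγ : |γ| ≤ w / 8)
    (hR : IsPolarSolution a b w r₀ γ R) (h0 : 0 < R 0) (hc : R (2 * Real.pi) = R 0) :
    |γ| ≤ a * (R 0 * Real.exp (2 * Real.pi)) ^ 2 := by
  have h1 : γ ≤ 0 := by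
    by_contra! hlt
    exact (hR.lt_of_pos h hγ h0 hlt).ne' hc
  rw [abs_of_nonpos h1]
  by_contra! hlt
  exact (hR.lt_of_neg h hγ h0 hlt).ne hc

lemma IsSmallRadius.abs_parameter_lt (h : IsSmallRadius a b w r₀) {x : ℝ} (hx : 0 < x)
    (hr : x * Real.exp (2 * Real.pi) ≤ r₀) : a * (x * Real.exp (2 * Real.pi)) ^ 2 < w / 8 := by
  have ha := h.a_pos
  have h1 : a * (x * Real.exp (2 * Real.pi)) ^ 2 ≤ a * r₀ ^ 2 := by gcongr
  linarith [h.le_speed, h.w_pos]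

lemma IsSmallRadius.exists_closed_solution (h : IsSmallRadius a b w r₀) {x : ℝ} (hx : 0 < x)
    (hr : x * Real.exp (2 * Real.pi) ≤ r₀) : ∃ γ R, |γ| ≤ w / 8 ∧ IsPolarSolution a b w r₀ γ R ∧
      R 0 = x ∧ R (2 * Real.pi) = x := by
  have hw := h.w_pos
  have hr0 := h.pos
  have hex (γ : ℝ) : ∃ R : ℝ → ℝ, |γ| ≤ w / 8 → R 0 = x ∧ IsPolarSolution a b w r₀ γ R := by
    by_cases hγ : |γ| ≤ w / 8
    · obtain ⟨R, hR⟩ := h.exists_isPolarSolution hγ x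
      exact ⟨R, fun _ => hR⟩
    · exact ⟨0, fun h => absurd h hγ⟩
  choose S hS using hex
  have hcont : ContinuousOn (fun γ => S γ (2 * Real.pi)) (Icc (-(w / 8)) (w / 8)) := by
    refine LipschitzOnWith.continuousOn
      (K := ⟨4 * r₀ / w * Real.exp (4 * Real.pi), by positivity⟩)
      (LipschitzOnWith.of_dist_le_mul fun γ₁ h₁ γ₂ h₂ => ?_)
    obtain ⟨e₁, s₁⟩ := hS γ₁ (abs_le.2 h₁)
    obtain ⟨e₂, s₂⟩ := hS γ₂ (abs_le.2 h₂)
    have := s₁.abs_sub_le h (abs_le.2 h₁) (abs_le.2 h₂) s₂ (θ := 2 * Real.pi)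
      ⟨by positivity, le_rfl⟩
    rw [e₁, e₂, sub_self, abs_zero, zero_add] at this
    rw [Real.dist_eq, Real.dist_eq]
    exact this.trans_eq (mul_right_comm _ _ _)
  have hp : |w / 8| ≤ w / 8 := (abs_of_pos (by positivity)).le
  have hn : |-(w / 8)| ≤ w / 8 := by rwa [abs_neg]
  obtain ⟨ep, sp⟩ := hS _ hp
  obtain ⟨en, sn⟩ := hS _ hn
  have h1 := sp.lt_of_pos h hp (ep ▸ hx) (by positivity)
  have h2 := sn.lt_of_neg h hn (en ▸ hx) (by
    rw [en, neg_neg]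
    exact h.abs_parameter_lt hx hr)
  rw [ep] at h1
  rw [en] at h2
  -- At `γ = -w/8` the orbit spirals in, at `γ = w/8` it spirals out; some parameter between them
  -- closes it.
  obtain ⟨γ, hγ, hγx⟩ := intermediate_value_Icc (by linarith) hcont ⟨h2.le, h1.le⟩
  obtain ⟨e, s⟩ := hS γ (abs_le.2 hγ)
  exact ⟨γ, S γ, abs_le.2 hγ, s, e, hγx⟩

/-- `R x`, for the parameter `μ x`, is the closed solution of the radial equation of initial radius
`x`, for all `x < ε₀`. -/
structure IsClosedFamily (a b w r₀ ε₀ : ℝ) (μ : ℝ → ℝ) (R : ℝ → ℝ → ℝ) : Prop where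
  parameter_le : ∀ x ∈ Ico 0 ε₀, |μ x| ≤ w / 8
  parameter_le_sq : ∀ x ∈ Ico 0 ε₀, |μ x| ≤ a * (x * Real.exp (2 * Real.pi)) ^ 2
  solution : ∀ x ∈ Ico 0 ε₀, IsPolarSolution a b w r₀ (μ x) (R x)
  start : ∀ x ∈ Ico 0 ε₀, R x 0 = x
  closed : ∀ x ∈ Ico 0 ε₀, R x (2 * Real.pi) = x
  zero : R 0 = fun _ => 0
  amplitude_le : ∀ x ∈ Ico 0 ε₀, x * Real.exp (2 * Real.pi) ≤ r₀

lemma IsSmallRadius.exists_isClosedFamily (h : IsSmallRadius a b w r₀) :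
    ∃ ε₀ > 0, ε₀ ≤ r₀ ∧ ∃ μ R, IsClosedFamily a b w r₀ ε₀ μ R := by
  have hr0 := h.pos
  have hw := h.w_pos
  have hlt (x : ℝ) (hx : x ∈ Ico 0 (r₀ / Real.exp (2 * Real.pi))) :
      x * Real.exp (2 * Real.pi) ≤ r₀ := ((lt_div_iff₀ (Real.exp_pos _)).1 hx.2).le
  have hex (x : ℝ) : ∃ (γ : ℝ) (R : ℝ → ℝ), x ∈ Ico 0 (r₀ / Real.exp (2 * Real.pi)) →
      |γ| ≤ w / 8 ∧ |γ| ≤ a * (x * Real.exp (2 * Real.pi)) ^ 2 ∧ IsPolarSolution a b w r₀ γ R ∧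
        R 0 = x ∧ R (2 * Real.pi) = x ∧ (x = 0 → R = fun _ => 0) := by
    by_cases hx : x ∈ Ico 0 (r₀ / Real.exp (2 * Real.pi))
    · rcases hx.1.eq_or_lt with rfl | hx0
      -- At amplitude 0 every parameter closes the zero solution; `γ = 0` is the choice that extends
      -- `μ` continuously.
      · exact ⟨0, fun _ => 0, fun _ => ⟨by simp; positivity, by simp,
          isPolarSolution_zero hr0.le, rfl, rfl, fun _ => rfl⟩⟩
      · obtain ⟨γ, R, hγ, hR, h0, hc⟩ := h.exists_closed_solution hx0 (hlt x hx)
        refine ⟨γ, R, fun _ => ⟨hγ, ?_, hR, h0, hc, fun h => absurd h hx0.ne'⟩⟩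
        have := hR.abs_parameter_le h hγ (h0 ▸ hx0) (hc.trans h0.symm)
        rwa [h0] at this
    · exact ⟨0, 0, fun h => absurd h hx⟩
  choose μ R hμR using hex
  exact ⟨_, div_pos hr0 (Real.exp_pos _), div_le_self hr0.le (Real.one_le_exp (by positivity)),
    μ, R, fun x hx => (hμR x hx).1, fun x hx => (hμR x hx).2.1, fun x hx => (hμR x hx).2.2.1,
    fun x hx => (hμR x hx).2.2.2.1, fun x hx => (hμR x hx).2.2.2.2.1,
    (hμR 0 ⟨le_rfl, div_pos hr0 (Real.exp_pos _)⟩).2.2.2.2.2 rfl, hlt⟩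

/-! ### Continuity of the parameter, the radial solutions and the period -/

variable {ε₀ : ℝ} {μ : ℝ → ℝ} {F : ℝ → ℝ → ℝ}

lemma IsClosedFamily.parameter_zero (hF : IsClosedFamily a b w r₀ ε₀ μ F) (hε : 0 < ε₀) :
    μ 0 = 0 := by
  simpa using hF.parameter_le_sq 0 ⟨le_rfl, hε⟩

lemma IsClosedFamily.parameter_lt (h : IsSmallRadius a b w r₀)
    (hF : IsClosedFamily a b w r₀ ε₀ μ F) {x : ℝ} (hx : x ∈ Ioo 0 ε₀) : |μ x| < w / 8 :=
  (hF.parameter_le_sq x (Ioo_subset_Ico_self hx)).trans_lt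
    (h.abs_parameter_lt hx.1 (hF.amplitude_le x (Ioo_subset_Ico_self hx)))

/-- The parameter of a closed orbit is bounded by any parameter at which the orbit of nearby
amplitude spirals outwards. -/
lemma IsClosedFamily.eventually_parameter_lt (h : IsSmallRadius a b w r₀)
    (hF : IsClosedFamily a b w r₀ ε₀ μ F) {x : ℝ} (hx : x ∈ Ioo 0 ε₀) (hγ : |γ| ≤ w / 8)
    (hlt : μ x < γ) : ∀ᶠ y in 𝓝 x, μ y < γ := by
  have hx' := Ioo_subset_Ico_self hx
  obtain ⟨S, hS0, hS⟩ := h.exists_isPolarSolution hγ x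
  have hd : x < S (2 * Real.pi) := by
    have := (hF.solution x hx').lt_of_lt h (hF.parameter_le x hx') hγ hlt hS
      (by rw [hF.start x hx']; exact hx.1) (by rw [hF.start x hx', hS0])
      (by rw [hF.start x hx']; exact hF.amplitude_le x hx')
    rwa [hF.closed x hx'] at this
  have hc : Continuous fun y => y + |x - y| * Real.exp (4 * Real.pi) := by fun_prop
  have hev : ∀ᶠ y in 𝓝 x, y + |x - y| * Real.exp (4 * Real.pi) < S (2 * Real.pi) :=
    hc.continuousAt.eventually_lt_const (by simpa using hd)
  filter_upwards [hev, isOpen_Ioo.mem_nhds hx] with y hy hymem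
  have hy' := Ioo_subset_Ico_self hymem
  obtain ⟨Z, hZ0, hZ⟩ := h.exists_isPolarSolution hγ y
  have hZS := hS.abs_sub_le h hγ hγ hZ (θ := 2 * Real.pi) ⟨by positivity, le_rfl⟩
  rw [hS0, hZ0, sub_self, abs_zero, mul_zero, add_zero] at hZS
  -- At parameter `γ` the orbit from `y` still spirals outwards. Were `μ y ≥ γ`, monotonicity in the
  -- parameter would make the orbit at `μ y` spiral outwards too, although it is closed.
  have hyZ : y < Z (2 * Real.pi) := by linarith [(abs_le.1 hZS).2]
  by_contra! hge
  have hfy := hF.solution y hy'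
  rcases hge.eq_or_lt with heq | hlt'
  · rw [← heq] at hfy
    have := hZ.eq h hγ hfy (θ₀ := 0) (by rw [hZ0, hF.start y hy'])
    rw [this, hF.closed y hy'] at hyZ
    exact hyZ.false
  · have := hZ.lt_of_lt h hγ (hF.parameter_le y hy') hlt' hfy (hZ0 ▸ hymem.1)
      (by rw [hZ0, hF.start y hy']) (hZ0 ▸ hF.amplitude_le y hy')
    rw [hF.closed y hy'] at this
    linarith

/-- The parameter of a closed orbit is bounded by any parameter at which the orbit of nearby
amplitude spirals inwards. -/
lemma IsClosedFamily.eventually_lt_parameter (h : IsSmallRadius a b w r₀)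
    (hF : IsClosedFamily a b w r₀ ε₀ μ F) {x : ℝ} (hx : x ∈ Ioo 0 ε₀) (hγ : |γ| ≤ w / 8)
    (hlt : γ < μ x) : ∀ᶠ y in 𝓝 x, γ < μ y := by
  have hx' := Ioo_subset_Ico_self hx
  obtain ⟨S, hS0, hS⟩ := h.exists_isPolarSolution hγ x
  have hd : S (2 * Real.pi) < x := by
    have := hS.lt_of_lt h hγ (hF.parameter_le x hx') hlt (hF.solution x hx') (hS0 ▸ hx.1)
      (by rw [hF.start x hx', hS0]) (hS0 ▸ hF.amplitude_le x hx')
    rwa [hF.closed x hx'] at this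
  have hc : Continuous fun y => y - |x - y| * Real.exp (4 * Real.pi) := by fun_prop
  have hev : ∀ᶠ y in 𝓝 x, S (2 * Real.pi) < y - |x - y| * Real.exp (4 * Real.pi) :=
    hc.continuousAt.eventually_const_lt (by simpa using hd)
  filter_upwards [hev, isOpen_Ioo.mem_nhds hx] with y hy hymem
  have hy' := Ioo_subset_Ico_self hymem
  obtain ⟨Z, hZ0, hZ⟩ := h.exists_isPolarSolution hγ y
  have hZS := hS.abs_sub_le h hγ hγ hZ (θ := 2 * Real.pi) ⟨by positivity, le_rfl⟩
  rw [hS0, hZ0, sub_self, abs_zero, mul_zero, add_zero] at hZS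
  have hyZ : Z (2 * Real.pi) < y := by linarith [(abs_le.1 hZS).1]
  by_contra! hge
  have hfy := hF.solution y hy'
  rcases hge.eq_or_lt with heq | hlt'
  · rw [heq] at hfy
    have := hZ.eq h hγ hfy (θ₀ := 0) (by rw [hZ0, hF.start y hy'])
    rw [this, hF.closed y hy'] at hyZ
    exact hyZ.false
  · have := hfy.lt_of_lt h (hF.parameter_le y hy') hγ hlt' hZ
      (by rw [hF.start y hy']; exact hymem.1) (by rw [hZ0, hF.start y hy'])
      (by rw [hF.start y hy']; exact hF.amplitude_le y hy')
    rw [hF.closed y hy'] at this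
    linarith

lemma IsClosedFamily.continuousOn_parameter (h : IsSmallRadius a b w r₀)
    (hF : IsClosedFamily a b w r₀ ε₀ μ F) : ContinuousOn μ (Ico 0 ε₀) := by
  intro x hx
  rcases hx.1.eq_or_lt with rfl | hx0
  · have h1 : Tendsto (fun x : ℝ => a * (x * Real.exp (2 * Real.pi)) ^ 2) (𝓝[Ico 0 ε₀] 0)
        (𝓝 0) := by
      have : Continuous fun x : ℝ => a * (x * Real.exp (2 * Real.pi)) ^ 2 := by fun_prop
      simpa using (this.tendsto 0).mono_left nhdsWithin_le_nhds
    rw [ContinuousWithinAt, hF.parameter_zero hx.2, tendsto_zero_iff_abs_tendsto_zero]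
    exact squeeze_zero' (Eventually.of_forall fun _ => abs_nonneg _)
      (eventually_mem_nhdsWithin.mono hF.parameter_le_sq) h1
  · have hxI : x ∈ Ioo 0 ε₀ := ⟨hx0, hx.2⟩
    refine ContinuousAt.continuousWithinAt (tendsto_order.2 ⟨fun c hc => ?_, fun c hc => ?_⟩)
    all_goals obtain ⟨h1, h2⟩ := abs_lt.1 (hF.parameter_lt h hxI)
    -- Test parameters must lie in `[-w/8, w/8]`, so `c` is clipped; the strict bound `|μ x| < w/8`
    -- keeps the clipped value on the correct side of `μ x`.
    · refine (hF.eventually_lt_parameter h hxI (γ := max c (-(w / 8))) ?_ (max_lt hc h1)).mono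
        fun y hy => (le_max_left _ _).trans_lt hy
      exact abs_le.2 ⟨le_max_right _ _, max_le (hc.trans h2).le (by linarith [h.w_pos])⟩
    · refine (hF.eventually_parameter_lt h hxI (γ := min c (w / 8)) ?_ (lt_min hc h2)).mono
        fun y hy => hy.trans_le (min_le_left _ _)
      exact abs_le.2 ⟨le_min (h1.trans hc).le (by linarith [h.w_pos]), min_le_right _ _⟩

lemma IsClosedFamily.continuousOn_solution (h : IsSmallRadius a b w r₀)
    (hF : IsClosedFamily a b w r₀ ε₀ μ F) {θ : ℝ} (hθ : θ ∈ Icc 0 (2 * Real.pi)) :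
    ContinuousOn (fun x => F x θ) (Ico 0 ε₀) := by
  intro x hx
  rw [ContinuousWithinAt, tendsto_iff_dist_tendsto_zero]
  have hlim : Tendsto (fun y => (|y - x| + 4 * r₀ / w * |μ y - μ x|) * Real.exp (4 * Real.pi))
      (𝓝[Ico 0 ε₀] x) (𝓝 0) := by
    have h1 : ContinuousWithinAt
        (fun y => (|y - x| + 4 * r₀ / w * |μ y - μ x|) * Real.exp (4 * Real.pi)) (Ico 0 ε₀) x := by
      have := hF.continuousOn_parameter h x hx
      fun_prop
    simpa [ContinuousWithinAt] using h1
  refine squeeze_zero' (Eventually.of_forall fun _ => dist_nonneg)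
    (eventually_mem_nhdsWithin.mono fun y hy => ?_) hlim
  have := (hF.solution y hy).abs_sub_le h (hF.parameter_le y hy) (hF.parameter_le x hx)
    (hF.solution x hx) hθ
  rwa [hF.start y hy, hF.start x hx] at this

/-- The duration of one turn along the radial solution `R`. -/
noncomputable def turnTime (a b w r₀ γ : ℝ) (R : ℝ → ℝ) : ℝ :=
  ∫ θ in (0 : ℝ)..2 * Real.pi, (angularSpeed a b w γ θ (clampRadius r₀ (R θ)))⁻¹

lemma IsClosedFamily.continuousOn_turnTime (h : IsSmallRadius a b w r₀)
    (hF : IsClosedFamily a b w r₀ ε₀ μ F) :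
    ContinuousOn (fun x => turnTime a b w r₀ (μ x) (F x)) (Ico 0 ε₀) := by
  intro x hx
  have hw := h.w_pos
  have hq (y : ℝ) (hy : y ∈ Ico 0 ε₀) (θ : ℝ) := h.angularSpeed_mem (θ := θ)
    (hF.parameter_le y hy) (clampRadius_mem h.pos.le (F y θ))
  have hq0 (y : ℝ) (hy : y ∈ Ico 0 ε₀) (θ : ℝ) := h.angularSpeed_pos (θ := θ)
    (hF.parameter_le y hy) (clampRadius_mem h.pos.le (F y θ))
  refine intervalIntegral.continuousWithinAt_of_dominated_interval
    (bound := fun _ => (3 * w / 4)⁻¹) (eventually_mem_nhdsWithin.mono fun y hy => ?_)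
    (eventually_mem_nhdsWithin.mono fun y hy => ?_) (by simp) ?_
  · have := (hF.solution y hy).continuous
    refine (Continuous.inv₀ ?_ fun θ => (hq0 y hy θ).ne').aestronglyMeasurable
    fun_prop
  · refine Eventually.of_forall fun θ _ => ?_
    rw [Real.norm_eq_abs, abs_of_pos (inv_pos.2 (hq0 y hy θ))]
    exact inv_anti₀ (by positivity) (hq y hy θ).1
  · refine Eventually.of_forall fun θ hθ => ?_
    rw [uIoc_of_le (by positivity)] at hθ
    have h1 := hF.continuousOn_parameter h x hx
    have h2 := hF.continuousOn_solution h (Ioc_subset_Icc_self hθ) x hx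
    have h3 := (continuous_clampRadius r₀).continuousAt.comp_continuousWithinAt h2
    refine ContinuousWithinAt.inv₀ ?_ (hq0 x hx θ).ne'
    unfold angularSpeed polarCoeff nonreciprocity
    simp only [Function.comp_def] at h3
    fun_prop

lemma IsClosedFamily.turnTime_zero (hF : IsClosedFamily a b w r₀ ε₀ μ F) (hε : 0 < ε₀)
    (hr : 0 ≤ r₀) : turnTime a b w r₀ (μ 0) (F 0) = 2 * Real.pi / w := by
  simp [turnTime, hF.zero, hF.parameter_zero hε, clampRadius_zero hr, angularSpeed, polarCoeff,
    nonreciprocity, div_eq_mul_inv]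

end Parameter

/-! ### Closed solutions of the radial equation give periodic orbits -/

/-- The angle as a function of time is the inverse of `τ(θ) = ∫₀^θ 1/q`. Since `1/q ≥ 1/C`, `τ` is
an increasing bijection of the line, and periodicity of `q` makes a shift of `θ` by `p` a constant
shift of `τ`. -/
lemma exists_time_change {q : ℝ → ℝ} {c C p : ℝ} (hq : Continuous q) (hc : 0 < c)
    (hqc : ∀ θ, q θ ∈ Icc c C) (hper : Function.Periodic q p) :
    ∃ Θ : ℝ → ℝ, Θ 0 = 0 ∧ (∀ t, HasDerivAt Θ (q (Θ t)) t) ∧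
      ∀ t, Θ (t + ∫ θ in (0 : ℝ)..p, (q θ)⁻¹) = Θ t + p := by
  have hq0 (θ : ℝ) : 0 < q θ := hc.trans_le (hqc θ).1
  have hC : 0 < C := hc.trans_le ((hqc 0).1.trans (hqc 0).2)
  have hinv : Continuous fun θ => (q θ)⁻¹ := hq.inv₀ fun θ => (hq0 θ).ne'
  set τ : ℝ → ℝ := fun θ => ∫ s in (0 : ℝ)..θ, (q s)⁻¹ with hτ
  have hd (θ : ℝ) : HasDerivAt τ (q θ)⁻¹ θ :=
    intervalIntegral.integral_hasDerivAt_right (hinv.intervalIntegrable _ _)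
      (hinv.stronglyMeasurableAtFilter _ _) hinv.continuousAt
  have hτ0 : τ 0 = 0 := by simp [hτ]
  have hcont : Continuous τ := continuous_iff_continuousAt.2 fun θ => (hd θ).continuousAt
  have hmono : StrictMono τ := strictMono_of_hasDerivAt_pos hd fun θ => inv_pos.2 (hq0 θ)
  have hlin : Monotone fun θ => τ θ - θ / C := by
    refine monotone_of_hasDerivAt_nonneg (fun θ => (hd θ).sub ((hasDerivAt_id' θ).div_const C))
      fun θ => ?_
    have := inv_anti₀ (hq0 θ) (hqc θ).2
    simpa using this
  have htop : Tendsto τ atTop atTop := by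
    refine tendsto_atTop_mono' _ ((eventually_ge_atTop 0).mono fun θ hθ => ?_)
      (tendsto_id.atTop_div_const hC)
    have := hlin hθ
    simp only [hτ0, zero_div, sub_zero] at this
    exact sub_nonneg.1 this
  have hbot : Tendsto τ atBot atBot := by
    refine tendsto_atBot_mono' _ ((eventually_le_atBot 0).mono fun θ hθ => ?_)
      (tendsto_id.atBot_div_const hC)
    have := hlin hθ
    simp only [hτ0, zero_div, sub_zero] at this
    exact sub_nonpos.1 this
  have hsurj : Function.Surjective τ := hcont.surjective htop hbot
  set e := hmono.orderIsoOfSurjective τ hsurj with he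
  have heτ (θ : ℝ) : e θ = τ θ := rfl
  refine ⟨e.symm, ?_, fun t => ?_, fun t => ?_⟩
  · rw [OrderIso.symm_apply_eq, heτ, hτ0]
  · have := HasDerivAt.of_local_left_inverse (f := τ) (g := e.symm) (a := t)
      e.symm.continuous.continuousAt (hd _) (inv_pos.2 (hq0 _)).ne'
      (Eventually.of_forall fun y => e.apply_symm_apply y)
    rwa [inv_inv] at this
  · rw [OrderIso.symm_apply_eq, heτ]
    have hshift (θ : ℝ) : τ (θ + p) = τ θ + ∫ s in (0 : ℝ)..p, (q s)⁻¹ := by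
      have h1 := intervalIntegral.integral_add_adjacent_intervals
        (hinv.intervalIntegrable (μ := MeasureTheory.volume) 0 θ)
        (hinv.intervalIntegrable θ (θ + p))
      have hper' : Function.Periodic (fun s => (q s)⁻¹) p := fun s => by simp only [hper s]
      have h2 := hper'.intervalIntegral_add_eq θ 0
      rw [zero_add] at h2
      rw [hτ]
      simp only
      rw [← h1, h2]
    rw [hshift, ← heτ, e.apply_symm_apply]

/-- The point of the phase plane with polar coordinates `r` and `θ`, for the frequency `w`. -/
noncomputable def polarPoint (w r θ : ℝ) : Fin 2 → ℝ := ![r * Real.cos θ, -(w * r * Real.sin θ)]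

lemma norm_polarPoint_le {w r : ℝ} (hw : 0 < w) (hr : 0 ≤ r) (θ : ℝ) :
    ‖polarPoint w r θ‖ ≤ (1 + w) * r := by
  refine (pi_norm_le_iff_of_nonneg (by positivity)).2 fun i => ?_
  have hwr : 0 ≤ w * r := by positivity
  fin_cases i
  · have : r * |Real.cos θ| ≤ r * 1 := by
      gcongr
      exact Real.abs_cos_le_one θ
    simp only [polarPoint, Fin.zero_eta, Matrix.cons_val_zero, Real.norm_eq_abs, abs_mul,
      abs_of_nonneg hr]
    linarith
  · have : w * r * |Real.sin θ| ≤ w * r * 1 := by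
      gcongr
      exact Real.abs_sin_le_one θ
    simp only [polarPoint, Fin.mk_one, Matrix.cons_val_one, Matrix.cons_val_fin_one,
      Real.norm_eq_abs, abs_neg]
    rw [abs_mul, abs_of_nonneg hwr]
    linarith

lemma hasDerivAt_polarPoint {a b E w γ t : ℝ} {r Θ : ℝ → ℝ} (hw : w ^ 2 = 2 * E)
    (hΘ : HasDerivAt Θ (angularSpeed a b w γ (Θ t) (r t)) t)
    (hr : HasDerivAt r (r t * (2 * polarCoeff a b γ (Θ t) (r t) * Real.sin (Θ t) ^ 2)) t) :
    HasDerivAt (fun t => polarPoint w (r t) (Θ t))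
      (phaseField a b E γ (polarPoint w (r t) (Θ t))) t := by
  rw [hasDerivAt_pi]
  intro i
  have hsc := Real.sin_sq_add_cos_sq (Θ t)
  fin_cases i
  · refine (hr.mul hΘ.cos).congr_deriv ?_
    simp only [polarPoint, phaseField, angularSpeed, Fin.zero_eta, Matrix.cons_val_zero,
      Matrix.cons_val_one, Matrix.cons_val_fin_one]
    ring
  · refine ((hr.const_mul w).mul hΘ.sin).neg.congr_deriv ?_
    simp only [polarPoint, phaseField, angularSpeed, polarCoeff, Fin.mk_one, Matrix.cons_val_zero,
      Matrix.cons_val_one, Matrix.cons_val_fin_one]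
    linear_combination (-(r t * Real.cos (Θ t))) * hw -
      2 * w * r t * nonreciprocity γ a b ((r t * Real.cos (Θ t)) ^ 2) * Real.sin (Θ t) * hsc

section PeriodicOrbit

variable {a b w r₀ γ E : ℝ} {R : ℝ → ℝ}

lemma IsPolarSolution.exists_periodic_orbit (h : IsSmallRadius a b w r₀) (hw : w ^ 2 = 2 * E)
    (hγ : |γ| ≤ w / 8) (hR : IsPolarSolution a b w r₀ γ R) (h0 : 0 < R 0)
    (hr : R 0 * Real.exp (2 * Real.pi) ≤ r₀) (hc : R (2 * Real.pi) = R 0) :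
    ∃ y : ℝ → Fin 2 → ℝ, y 0 = ![R 0, 0] ∧ IsIntegralCurve y (fun _ => phaseField a b E γ) ∧
      IsLeast {τ : ℝ | 0 < τ ∧ Function.Periodic y τ} (turnTime a b w r₀ γ R) ∧
      ∀ t, ‖y t‖ ≤ (1 + w) * (R 0 * Real.exp (2 * Real.pi)) := by
  have hper := hR.periodic h hγ hc
  have hw0 := h.w_pos
  have hle (θ : ℝ) : R θ ≤ R 0 * Real.exp (2 * Real.pi) := by
    obtain ⟨s, hs, he⟩ := hper.exists_mem_Ico₀ (by positivity) θ
    rw [he]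
    exact hR.le_mul_exp_two_pi h hγ h0 (Ico_subset_Icc_self hs)
  have hpos := hR.pos h hγ h0
  have hmem (θ : ℝ) : R θ ∈ Icc 0 r₀ := ⟨(hpos θ).le, (hle θ).trans hr⟩
  set q : ℝ → ℝ := fun θ => angularSpeed a b w γ θ (R θ) with hq
  have hRc := hR.continuous
  have hqmem (θ : ℝ) : q θ ∈ Icc (3 * w / 4) (5 * w / 4) := h.angularSpeed_mem hγ (hmem θ)
  have hqper : Function.Periodic q (2 * Real.pi) := fun θ => by
    simp only [hq, angularSpeed_add_two_pi, hper θ]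
  obtain ⟨Θ, hΘ0, hΘ, hshift⟩ := exists_time_change (by fun_prop) (by positivity) hqmem hqper
  have hT : turnTime a b w r₀ γ R = ∫ θ in (0 : ℝ)..2 * Real.pi, (q θ)⁻¹ := by
    simp only [turnTime, hq, clampRadius_of_mem (hmem _)]
  have hq0 (θ : ℝ) : 0 < q θ := h.angularSpeed_pos hγ (hmem θ)
  have hmono : StrictMono Θ := strictMono_of_hasDerivAt_pos hΘ fun t => hq0 _
  have hΘT : Θ (turnTime a b w r₀ γ R) = 2 * Real.pi := by
    have := hshift 0
    rwa [zero_add, hΘ0, zero_add, ← hT] at this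
  refine ⟨fun t => polarPoint w (R (Θ t)) (Θ t), ?_, fun t => ?_, ⟨⟨?_, fun t => ?_⟩, ?_⟩,
    fun t => ?_⟩
  · simp [polarPoint, hΘ0]
  · refine hasDerivAt_polarPoint hw (hΘ t) (((hR (Θ t)).comp t (hΘ t)).congr_deriv ?_)
    rw [polarField_of_mem (hmem _), mul_assoc, radialRate_mul_angularSpeed (hq0 _).ne']
  · rw [← hmono.lt_iff_lt, hΘT, hΘ0]
    positivity
  · simp only [hT, hshift, hper (Θ t)]
    simp [polarPoint]
  -- Minimality: returning to the point `(R 0, 0)` forces `sin Θ(τ) = 0` and `cos Θ(τ) > 0`, so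
  -- `Θ(τ)` is a positive multiple of `2π`, hence at least the angle reached at the turn time.
  · rintro τ ⟨hτ, hτper⟩
    have h1 := hτper 0
    simp only [zero_add, hΘ0] at h1
    have hcos : R (Θ τ) * Real.cos (Θ τ) = R 0 := by simpa [polarPoint] using congrFun h1 0
    have hsin : Real.sin (Θ τ) = 0 := by
      have := congrFun h1 1
      simpa [polarPoint, hw0.ne', (hpos (Θ τ)).ne'] using this
    have hcos' : 0 < Real.cos (Θ τ) :=
      pos_of_mul_pos_right (hcos ▸ h0) (hpos _).le
    have hcos1 : Real.cos (Θ τ) = 1 := by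
      nlinarith [Real.sin_sq_add_cos_sq (Θ τ)]
    obtain ⟨k, hk⟩ := (Real.cos_eq_one_iff _).1 hcos1
    have hpos' : 0 < Θ τ := by
      rw [← hΘ0]
      exact hmono hτ
    have hk1 : (1 : ℤ) ≤ k := by
      rw [← hk] at hpos'
      have : (0 : ℝ) < k := pos_of_mul_pos_left hpos' (by positivity)
      exact_mod_cast this
    have hk1' : (1 : ℝ) ≤ k := by exact_mod_cast hk1
    rw [← hmono.le_iff_le, hΘT, ← hk]
    nlinarith [Real.pi_pos]
  · exact (norm_polarPoint_le hw0 (hpos _).le _).trans (by gcongr; exact hle _)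

end PeriodicOrbit

/-! ### Small periodic orbits come from closed solutions of the radial equation -/

/-- A `C¹` field is Lipschitz on the compact ball containing both curves, which suffices for
uniqueness. -/
lemma IsIntegralCurve.eq_of_bounded {f : (Fin 2 → ℝ) → (Fin 2 → ℝ)} (hf : ContDiff ℝ 1 f)
    {y₁ y₂ : ℝ → Fin 2 → ℝ} (h₁ : IsIntegralCurve y₁ fun _ => f)
    (h₂ : IsIntegralCurve y₂ fun _ => f) {C : ℝ} (hb₁ : ∀ t, ‖y₁ t‖ ≤ C) (hb₂ : ∀ t, ‖y₂ t‖ ≤ C)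
    {t₀ : ℝ} (h0 : y₁ t₀ = y₂ t₀) : y₁ = y₂ := by
  obtain ⟨K, hK⟩ := (hf.locallyLipschitz.locallyLipschitzOn
    (s := Metric.closedBall (0 : Fin 2 → ℝ) C)).exists_lipschitzOnWith_of_compact
      (isCompact_closedBall 0 C)
  exact ODE_solution_unique_univ (v := fun _ => f) (s := fun _ => Metric.closedBall 0 C)
    (fun _ => hK) (fun t => ⟨h₁ t, mem_closedBall_zero_iff.2 (hb₁ t)⟩)
    (fun t => ⟨h₂ t, mem_closedBall_zero_iff.2 (hb₂ t)⟩) h0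

lemma eq_of_hasDerivAt_zero {f : ℝ → ℝ} (hf : ∀ t, HasDerivAt f 0 t) (s t : ℝ) : f s = f t :=
  is_const_of_deriv_eq_zero (fun t => (hf t).differentiableAt) (fun t => (hf t).deriv) s t

/-- A planar curve that rotates and expands at given continuous rates has polar coordinates. -/
lemma exists_polar_lift {X Z P Q : ℝ → ℝ} (hQ : Continuous Q)
    (hX : ∀ t, HasDerivAt X (P t * X t - Q t * Z t) t)
    (hZ : ∀ t, HasDerivAt Z (P t * Z t + Q t * X t) t) (hne : ∀ t, 0 < X t ^ 2 + Z t ^ 2) :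
    ∃ r Θ : ℝ → ℝ, (∀ t, 0 < r t) ∧ (∀ t, r t ^ 2 = X t ^ 2 + Z t ^ 2) ∧
      (∀ t, X t = r t * Real.cos (Θ t)) ∧ (∀ t, Z t = r t * Real.sin (Θ t)) ∧
      (∀ t, HasDerivAt r (r t * P t) t) ∧ ∀ t, HasDerivAt Θ (Q t) t := by
  set r : ℝ → ℝ := fun t => Real.sqrt (X t ^ 2 + Z t ^ 2) with hr
  have hr0 (t : ℝ) : 0 < r t := Real.sqrt_pos.2 (hne t)
  have hr2 (t : ℝ) : r t ^ 2 = X t ^ 2 + Z t ^ 2 := Real.sq_sqrt (hne t).le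
  have hrd (t : ℝ) : HasDerivAt r (r t * P t) t := by
    refine ((((hX t).pow 2).add ((hZ t).pow 2)).sqrt (hne t).ne').congr_deriv ?_
    have h1 : Real.sqrt ((X ^ 2 + Z ^ 2) t) = r t := rfl
    rw [h1, div_eq_iff (by have := hr0 t; positivity)]
    simp only [Nat.cast_ofNat, Nat.add_one_sub_one, pow_one]
    linear_combination (-2 * P t) * hr2 t
  set z : ℂ := ⟨X 0, Z 0⟩ with hz
  set Θ : ℝ → ℝ := fun t => z.arg + ∫ s in (0 : ℝ)..t, Q s with hΘ
  have hΘ0 : Θ 0 = z.arg := by simp [hΘ]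
  have hΘd (t : ℝ) : HasDerivAt Θ (Q t) t :=
    (intervalIntegral.integral_hasDerivAt_right (hQ.intervalIntegrable _ _)
      (hQ.stronglyMeasurableAtFilter _ _) hQ.continuousAt).const_add _
  have hnorm : ‖z‖ = r 0 := by
    rw [Complex.norm_def, Complex.normSq_apply, hr]
    simp only [hz, sq]
  have hX0 : X 0 = r 0 * Real.cos (Θ 0) := by
    rw [hΘ0, ← hnorm, Complex.norm_mul_cos_arg]
  have hZ0 : Z 0 = r 0 * Real.sin (Θ 0) := by
    rw [hΘ0, ← hnorm, Complex.norm_mul_sin_arg]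
  -- With `Θ` defined as the integral of `Q` started at the argument of the initial point, the
  -- number `(X + iZ) e^{-iΘ} / r` has zero derivative. `hA` and `hB` are its real and imaginary
  -- parts.
  have hA (t : ℝ) : (X t * Real.cos (Θ t) + Z t * Real.sin (Θ t)) / r t = 1 := by
    have hd (t : ℝ) : HasDerivAt
        (fun t => (X t * Real.cos (Θ t) + Z t * Real.sin (Θ t)) / r t) 0 t := by
      refine ((((hX t).mul (hΘd t).cos).add ((hZ t).mul (hΘd t).sin)).div (hrd t)
        (hr0 t).ne').congr_deriv ?_
      rw [div_eq_zero_iff]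
      left
      simp only [Pi.add_apply, Pi.mul_apply]
      ring
    rw [eq_of_hasDerivAt_zero hd t 0, div_eq_one_iff_eq (hr0 0).ne', hX0, hZ0]
    linear_combination r 0 * Real.sin_sq_add_cos_sq (Θ 0)
  have hB (t : ℝ) : (Z t * Real.cos (Θ t) - X t * Real.sin (Θ t)) / r t = 0 := by
    have hd (t : ℝ) : HasDerivAt
        (fun t => (Z t * Real.cos (Θ t) - X t * Real.sin (Θ t)) / r t) 0 t := by
      refine ((((hZ t).mul (hΘd t).cos).sub ((hX t).mul (hΘd t).sin)).div (hrd t)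
        (hr0 t).ne').congr_deriv ?_
      rw [div_eq_zero_iff]
      left
      simp only [Pi.sub_apply, Pi.mul_apply]
      ring
    rw [eq_of_hasDerivAt_zero hd t 0, div_eq_zero_iff]
    left
    rw [hX0, hZ0]
    ring
  have hA' (t : ℝ) := (div_eq_one_iff_eq (hr0 t).ne').1 (hA t)
  have hB' (t : ℝ) := (div_eq_zero_iff.1 (hB t)).resolve_right (hr0 t).ne'
  refine ⟨r, Θ, hr0, hr2, fun t => ?_, fun t => ?_, hrd, hΘd⟩
  · linear_combination Real.cos (Θ t) * hA' t - Real.sin (Θ t) * hB' t -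
      X t * Real.sin_sq_add_cos_sq (Θ t)
  · linear_combination Real.sin (Θ t) * hA' t + Real.cos (Θ t) * hB' t -
      Z t * Real.sin_sq_add_cos_sq (Θ t)

section Exhaustion

variable {a b w r₀ γ E ε₀ : ℝ} {μ : ℝ → ℝ} {F : ℝ → ℝ → ℝ}

lemma exists_polar_lift_of_isIntegralCurve (hw0 : 0 < w) (hw : w ^ 2 = 2 * E)
    {y : ℝ → Fin 2 → ℝ} (hy : IsIntegralCurve y fun _ => phaseField a b E γ)
    (hne : ∀ t, y t ≠ 0) :
    ∃ r Θ : ℝ → ℝ, (∀ t, 0 < r t) ∧ (∀ t, r t ^ 2 = y t 0 ^ 2 + (y t 1 / w) ^ 2) ∧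
      (∀ t, y t = polarPoint w (r t) (Θ t)) ∧
      (∀ t, HasDerivAt r (r t * (2 * polarCoeff a b γ (Θ t) (r t) * Real.sin (Θ t) ^ 2)) t) ∧
      ∀ t, HasDerivAt Θ (angularSpeed a b w γ (Θ t) (r t)) t := by
  set X : ℝ → ℝ := fun t => y t 0 with hX
  set Z : ℝ → ℝ := fun t => -(y t 1 / w) with hZ
  set G : ℝ → ℝ := fun t => nonreciprocity γ a b (y t 0 ^ 2) with hG
  have hy' (t : ℝ) (i : Fin 2) := hasDerivAt_pi.1 (hy t) i
  have hyc := hy.continuous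
  have hGc : Continuous G := by
    simp only [hG, nonreciprocity]
    fun_prop
  have hN (t : ℝ) : 0 < X t ^ 2 + Z t ^ 2 := by
    by_contra! hle
    have h0 : X t = 0 := by nlinarith [sq_nonneg (X t), sq_nonneg (Z t)]
    have h1 : Z t = 0 := by nlinarith [sq_nonneg (X t), sq_nonneg (Z t)]
    refine hne t (funext fun i => ?_)
    fin_cases i
    · exact h0
    · simpa [hZ, hw0.ne'] using h1
  have hv (t : ℝ) : y t 1 = -(w * Z t) := by
    simp only [hZ]
    field_simp
  obtain ⟨r, Θ, hr0, hr2, hXr, hZr, hrd, hΘd⟩ := exists_polar_lift (X := X) (Z := Z)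
    (P := fun t => 2 * G t * Z t ^ 2 / (X t ^ 2 + Z t ^ 2))
    (Q := fun t => w + 2 * G t * X t * Z t / (X t ^ 2 + Z t ^ 2))
    (by
      refine continuous_const.add (Continuous.div ?_ ?_ fun t => (hN t).ne') <;>
        simp only [hX, hZ] <;> fun_prop)
    (fun t => by
      refine (hy' t 0).congr_deriv ?_
      have := (hN t).ne'
      simp only [phaseField, Matrix.cons_val_zero, hv]
      field_simp
      ring)
    (fun t => by
      refine ((hy' t 1).div_const w).neg.congr_deriv ?_
      have := (hN t).ne'
      have hGt : nonreciprocity γ a b (y t 0 ^ 2) = G t := rfl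
      have hXt : y t 0 = X t := rfl
      simp only [phaseField, Matrix.cons_val_one, Matrix.cons_val_fin_one, hv, ← hw, hGt]
      rw [hXt]
      field_simp
      ring) hN
  have hGr (t : ℝ) : G t = polarCoeff a b γ (Θ t) (r t) := by
    rw [polarCoeff, ← hXr]
  refine ⟨r, Θ, hr0, fun t => by rw [hr2]; simp only [hX, hZ, neg_sq], fun t => ?_, fun t => ?_,
    fun t => ?_⟩
  · funext i
    fin_cases i
    · exact hXr t
    · simp only [Fin.mk_one, hv, polarPoint, hZr, Matrix.cons_val_one, Matrix.cons_val_fin_one]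
      ring
  · refine (hrd t).congr_deriv ?_
    rw [← hr2, hGr, hZr]
    have := (hr0 t).ne'
    field_simp
  · refine (hΘd t).congr_deriv ?_
    rw [← hr2, hGr, hZr, hXr, angularSpeed]
    have := (hr0 t).ne'
    field_simp

/-- Along a solution, the radius is a solution of the radial equation in terms of the angle. -/
lemma IsPolarSolution.comp_angle_eq (h : IsSmallRadius a b w r₀) (hγ : |γ| ≤ w / 8)
    {R r Θ : ℝ → ℝ} (hR : IsPolarSolution a b w r₀ γ R) (hr : ∀ t, r t ∈ Icc 0 r₀)
    (hrd : ∀ t, HasDerivAt r (r t * (2 * polarCoeff a b γ (Θ t) (r t) * Real.sin (Θ t) ^ 2)) t)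
    (hΘ : ∀ t, HasDerivAt Θ (angularSpeed a b w γ (Θ t) (r t)) t) {t₀ : ℝ}
    (h0 : R (Θ t₀) = r t₀) (t : ℝ) : R (Θ t) = r t := by
  have hw := h.w_pos
  have hq (t : ℝ) := h.angularSpeed_mem (θ := Θ t) hγ (hr t)
  -- In the comparison equation the angular speed is evaluated along the given `r`, as a known
  -- function of time. The right-hand side is thus Lipschitz in `x`, and both `R ∘ Θ` and `r` solve
  -- it.
  refine congrFun (ODE_solution_unique_univ (f := fun t => R (Θ t)) (t₀ := t₀)
    (v := fun t x => polarField a b w r₀ γ (Θ t) x * angularSpeed a b w γ (Θ t) (r t))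
    (s := fun _ => univ) (K := 2 * (5 * w / 4).toNNReal) (fun t => ?_)
    (fun t => ⟨(hR (Θ t)).comp t (hΘ t), trivial⟩) (fun t => ⟨?_, trivial⟩) h0) t
  · refine LipschitzOnWith.of_dist_le_mul fun x _ z _ => ?_
    have h1 := (h.lipschitzWith_polarField hγ (Θ t)).dist_le_mul x z
    rw [Real.dist_eq] at h1 ⊢
    rw [← sub_mul, abs_mul, abs_of_pos (h.angularSpeed_pos hγ (hr t))]
    refine (mul_le_mul h1 (hq t).2 (by linarith [(hq t).1]) (by positivity)).trans_eq ?_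
    rw [NNReal.coe_mul, Real.coe_toNNReal _ (by positivity)]
    exact mul_right_comm _ _ _
  · refine (hrd t).congr_deriv ?_
    rw [polarField_of_mem (hr t), mul_assoc (r t) (radialRate _ _ _ _ _ _),
      radialRate_mul_angularSpeed (h.angularSpeed_pos hγ (hr t)).ne']

lemma IsClosedFamily.exists_amplitude (h : IsSmallRadius a b w r₀) (hw : w ^ 2 = 2 * E)
    (hε : ε₀ ≤ r₀) (hF : IsClosedFamily a b w r₀ ε₀ μ F) {y : ℝ → Fin 2 → ℝ}
    (hγ : |γ| ≤ w / 8) (hy : IsIntegralCurve y fun _ => phaseField a b E γ)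
    (hper : ∃ τ > 0, Function.Periodic y τ) (hcst : ¬ ∃ x, ∀ t, y t = x)
    (hsmall : ∀ t, ‖y t‖ < ε₀ / (1 + 1 / w)) :
    ∃ x ∈ Ioo 0 ε₀, μ x = γ ∧ ![x, 0] ∈ range y := by
  have hw0 := h.w_pos
  have hε0 : 0 < ε₀ := by
    have := (norm_nonneg _).trans_lt (hsmall 0)
    exact (div_pos_iff_of_pos_right (by positivity)).1 this
  -- A curve that meets the equilibrium is constant by uniqueness, which is excluded.
  have hne (t : ℝ) : y t ≠ 0 := by
    intro h0
    have hf : ContDiff ℝ 1 (phaseField a b E γ) :=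
      ((contDiff_phaseField a b E).comp (contDiff_prodMk_right γ)).of_le (by exact_mod_cast le_top)
    have hz : IsIntegralCurve (fun _ : ℝ => (0 : Fin 2 → ℝ)) fun _ => phaseField a b E γ :=
      isIntegralCurve_const fun _ => phaseField_zero a b E γ
    have := hy.eq_of_bounded hf hz (fun t => (hsmall t).le)
      (fun t => by simpa using (by positivity : 0 ≤ ε₀ / (1 + 1 / w))) h0
    exact hcst ⟨0, fun t => congrFun this t⟩
  obtain ⟨r, Θ, hr0, hr2, hyr, hrd, hΘd⟩ := exists_polar_lift_of_isIntegralCurve hw0 hw hy hne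
  have hrε (t : ℝ) : r t < ε₀ := by
    refine lt_of_pow_lt_pow_left₀ 2 hε0.le ?_
    have hi (i : Fin 2) : y t i ^ 2 ≤ ‖y t‖ ^ 2 := by
      rw [← sq_abs]
      gcongr
      exact norm_le_pi_norm (y t) i
    have h1 : r t ^ 2 ≤ ‖y t‖ ^ 2 * (1 + 1 / w) ^ 2 := by
      have h2 : y t 1 ^ 2 * (1 / w) ^ 2 ≤ ‖y t‖ ^ 2 * (1 / w) ^ 2 :=
        mul_le_mul_of_nonneg_right (hi 1) (sq_nonneg _)
      have h3 : 0 ≤ ‖y t‖ ^ 2 * (1 / w) := by positivity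
      rw [hr2, div_eq_mul_one_div (y t 1), mul_pow]
      linarith [hi 0]
    have h4 : ‖y t‖ ^ 2 * (1 + 1 / w) ^ 2 < ε₀ ^ 2 := by
      rw [← mul_pow]
      have := (lt_div_iff₀ (by positivity)).1 (hsmall t)
      gcongr
    exact h1.trans_lt h4
  have hmem (t : ℝ) : r t ∈ Icc 0 r₀ := ⟨(hr0 t).le, (hrε t).le.trans hε⟩
  have hq (t : ℝ) := h.angularSpeed_mem (θ := Θ t) hγ (hmem t)
  have hmono : StrictMono Θ :=
    strictMono_of_hasDerivAt_pos hΘd fun t => h.angularSpeed_pos hγ (hmem t)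
  have hΘc : Continuous Θ := continuous_iff_continuousAt.2 fun t => (hΘd t).continuousAt
  have hlin : Monotone fun t => Θ t - 3 * w / 4 * t :=
    monotone_of_hasDerivAt_nonneg
      (fun t => (hΘd t).sub ((hasDerivAt_id' t).const_mul (3 * w / 4))) fun t => by
        have := (hq t).1
        simpa using this
  -- The angle advances with speed at least `3w/4`, so it passes 0 within the time `|Θ 0| / (3w/4)`
  -- forwards or backwards. The radius at that time is the amplitude sought.
  obtain ⟨t₀, ht₀⟩ : ∃ t₀, Θ t₀ = 0 := by
    set s := |Θ 0| / (3 * w / 4) with hs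
    have hs0 : 0 ≤ s := by positivity
    have hsw : 3 * w / 4 * s = |Θ 0| := by
      rw [hs]
      field_simp
    have h1 := hlin hs0
    have h2 := hlin (neg_nonpos.2 hs0)
    simp only [mul_zero, sub_zero, mul_neg, hsw] at h1 h2
    have hmem0 : (0 : ℝ) ∈ Icc (Θ (-s)) (Θ s) :=
      ⟨by linarith [le_abs_self (Θ 0)], by linarith [neg_abs_le (Θ 0)]⟩
    obtain ⟨t₀, -, ht₀⟩ := intermediate_value_Icc (by linarith) hΘc.continuousOn hmem0
    exact ⟨t₀, ht₀⟩
  obtain ⟨R, hR0, hR⟩ := h.exists_isPolarSolution hγ (r t₀)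
  have hRr := hR.comp_angle_eq h hγ hmem hrd hΘd (t₀ := t₀) (by rw [ht₀, hR0])
  have hyt₀ : y t₀ = ![r t₀, 0] := by
    rw [hyr, ht₀]
    simp [polarPoint]
  obtain ⟨τ, hτ, hτper⟩ := hper
  have hyτ : polarPoint w (r (t₀ + τ)) (Θ (t₀ + τ)) = ![r t₀, 0] := by
    rw [← hyr, hτper, hyt₀]
  have hrτ : r (t₀ + τ) = r t₀ := by
    refine (pow_left_inj₀ (hr0 _).le (hr0 _).le two_ne_zero).1 ?_
    rw [hr2, hr2, hτper]
  have hcos : Real.cos (Θ (t₀ + τ)) = 1 := by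
    have := congrFun hyτ 0
    simp only [polarPoint, Matrix.cons_val_zero, hrτ] at this
    exact (mul_eq_left₀ (hr0 t₀).ne').1 this
  obtain ⟨k, hk⟩ := (Real.cos_eq_one_iff _).1 hcos
  have hpos : 0 < Θ (t₀ + τ) := by
    rw [← ht₀]
    exact hmono (by linarith)
  have hk0 : 0 < k := by
    rw [← hk] at hpos
    have : (0 : ℝ) < k := pos_of_mul_pos_left hpos (by positivity)
    exact_mod_cast this
  lift k to ℕ using hk0.le
  -- One time period covers `k ≥ 1` turns, and closing after `k` turns forces closing after one.
  have hclosed : R (2 * Real.pi) = R 0 := by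
    refine hR.eq_of_iterate_eq h hγ (k := k) (by exact_mod_cast hk0) ?_
    rw [Int.cast_natCast] at hk
    rw [hk, hRr, hrτ, hR0]
  have hx : r t₀ ∈ Ioo 0 ε₀ := ⟨hr0 t₀, hrε t₀⟩
  have hx' := Ioo_subset_Ico_self hx
  refine ⟨r t₀, hx, ?_, t₀, hyt₀⟩
  refine (hF.solution _ hx').parameter_unique h (hF.parameter_le _ hx') hγ hR ?_ ?_ ?_ ?_
  · rw [hF.start _ hx']
    exact hx.1
  · rw [hF.start _ hx', hR0]
  · rw [hF.start _ hx']
    exact hF.amplitude_le _ hx'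
  · rw [hF.closed _ hx', hclosed, hR0]

end Exhaustion

/-! ### The Hopf bifurcation -/

lemma exists_isSmallRadius {a b w : ℝ} (ha : 0 < a) (hb : 0 < b) (hw : 0 < w) :
    ∃ r₀, IsSmallRadius a b w r₀ := by
  have hpos : 0 < min (w / 16 / a) (a / b) := by positivity
  have hsq := Real.sq_sqrt hpos.le
  refine ⟨Real.sqrt (min (w / 16 / a) (a / b)), ha, hb, hw, Real.sqrt_pos.2 hpos, ?_, ?_⟩
  · rw [hsq, mul_comm, ← le_div_iff₀ ha]
    exact min_le_left _ _
  · rw [hsq, mul_comm, ← le_div_iff₀ hb]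
    exact min_le_right _ _

theorem isHopfBifurcation_phaseField {a b E : ℝ} (ha : 0 < a) (hb : 0 < b) (hE : 0 < E) :
    IsHopfBifurcation (phaseField a b E) 0 0 (Real.sqrt (2 * E)) where
  smooth := contDiff_phaseField a b E
  equilibrium := Eventually.of_forall (phaseField_zero a b E)
  frequency_pos := by positivity
  eigenvalues := complexEigenvalues_jacobian_phaseField_zero a b hE
  transversality := eigenvalue_crossing_phaseField a b hE
  stability_exchange := Or.inl
    ⟨eventually_mem_nhdsWithin.mono fun _ hp => isAsymptoticallyStable_phaseField a b hE hp,
      eventually_mem_nhdsWithin.mono fun _ hp => isRepelling_phaseField a b hE hp⟩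
  periodic_orbits := by
    have hw0 : 0 < Real.sqrt (2 * E) := by positivity
    have hw : Real.sqrt (2 * E) ^ 2 = 2 * E := Real.sq_sqrt (by positivity)
    generalize Real.sqrt (2 * E) = w at hw0 hw
    obtain ⟨r₀, h⟩ := exists_isSmallRadius ha hb hw0
    obtain ⟨ε₀, hε₀, hεr, μ, F, hF⟩ := h.exists_isClosedFamily
    have hex (x : ℝ) : ∃ y : ℝ → Fin 2 → ℝ, y 0 = ![x, 0] ∧ (x ∈ Ioo 0 ε₀ →
        IsIntegralCurve y (fun _ => phaseField a b E (μ x)) ∧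
        IsLeast {τ : ℝ | 0 < τ ∧ Function.Periodic y τ} (turnTime a b w r₀ (μ x) (F x)) ∧
        ∀ t, ‖y t‖ ≤ (1 + w) * (x * Real.exp (2 * Real.pi))) := by
      by_cases hx : x ∈ Ioo 0 ε₀
      · have hx' := Ioo_subset_Ico_self hx
        have h0 := hF.start x hx'
        obtain ⟨y, hy0, hy⟩ := (hF.solution x hx').exists_periodic_orbit h hw
          (hF.parameter_le x hx') (by rw [h0]; exact hx.1) (by rw [h0]; exact hF.amplitude_le x hx')
          ((hF.closed x hx').trans h0.symm)
        rw [h0] at hy0 hy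
        exact ⟨y, hy0, fun _ => hy⟩
      -- The constant default keeps `Y x 0 = ![x, 0]` for every `x`, which gives the value at 0 and
      -- the continuity of the starting points.
      · exact ⟨fun _ => ![x, 0], rfl, fun h => absurd h hx⟩
    choose Y hY0 hY using hex
    refine ⟨ε₀, μ, fun x => turnTime a b w r₀ (μ x) (F x), Y, hε₀, hF.continuousOn_parameter h,
      hF.continuousOn_turnTime h, ?_, hF.parameter_zero hε₀, hF.turnTime_zero hε₀ h.pos.le, ?_,
      fun x hx => ⟨(hY x hx).1, (hY x hx).2.1⟩, fun r hr => ?_,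
      ε₀ / (1 + 1 / w), by positivity, w / 8, by positivity, ?_⟩
    · simp only [hY0]
      fun_prop
    · rw [hY0]
      ext i
      fin_cases i <;> rfl
    · have hc : Continuous fun x => (1 + w) * (x * Real.exp (2 * Real.pi)) := by fun_prop
      have h1 : ∀ᶠ x in 𝓝[>] (0 : ℝ), (1 + w) * (x * Real.exp (2 * Real.pi)) < r :=
        (hc.continuousAt.eventually_lt_const (by simpa using hr)).filter_mono nhdsWithin_le_nhds
      filter_upwards [h1, Ioo_mem_nhdsGT hε₀] with x hx hxε t
      rw [dist_zero_right]
      exact ((hY x hxε).2.2 t).trans_lt hx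
    · intro p y hp hy hper hcst hsmall
      rw [sub_zero] at hp
      obtain ⟨x, hx, hμ, hrange⟩ := hF.exists_amplitude h hw hεr hp.le hy hper hcst
        fun t => by simpa using hsmall t
      exact ⟨x, hx, hμ, by rwa [hY0]⟩

theorem mainTheorem5 (a b E : ℝ) (ha : 0 < a) (hb : 0 < b) (hE : 0 < E) :
    (∀ γ : ℝ, jacobian (phaseField a b E γ) 0 = !![0, 1; -2 * E, 2 * γ]) ∧
    (∀ γ : ℝ, (jacobian (phaseField a b E γ) 0).trace = 2 * γ) ∧
    (∀ γ : ℝ, (jacobian (phaseField a b E γ) 0).det = 2 * E) ∧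
    0 < 2 * E ∧
    HasDerivAt (fun γ : ℝ => (jacobian (phaseField a b E γ) 0).trace) 2 0 ∧
    IsHopfBifurcation (phaseField a b E) 0 0 (Real.sqrt (2 * E)) := by
  refine ⟨jacobian_phaseField_zero a b E, trace_jacobian_phaseField_zero a b E,
    det_jacobian_phaseField_zero a b E, by positivity, ?_, isHopfBifurcation_phaseField ha hb hE⟩
  simp only [trace_jacobian_phaseField_zero]
  simpa using (hasDerivAt_id' (0 : ℝ)).const_mul 2
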